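/- A holomorphic foliation $\mathcal F$ of degree $d$ on $\mathbb P^2_{\mathbb C}$ is given by a homogeneous $1$-form $\Omega=a\,dx+b\,dy+c\,dz$ with $a,b,c\in\mathbb C[x,y,z]_{d+1}$ without common factor and $xa+yb+zc=0$; its singular points are the common zeros of $a,b,c$. The foliation is called convex if its leaves other than straight lines have no inflection points. A foliation of degree $d\ge 1$ has at most $3d$ distinct invariant lines; it is called reduced convex if it has exactly $3d$ distinct invariant lines (it is then convex). A singular point $s$ is non-degenerate if the linear part at $s$ of a local vector field defining $\mathcal F$ near $s$ (with an isolated zero at $s$) is invertible. If $\ell$ is an invariant line, $s\in\ell$ is a singular point, and $\mathcal F$ is given by $\alpha\,du+\beta\,dv$ in an affine chart $(u,v)$ centred at $s$ with $\ell=\{v=0\}$, the Camacho–Sad index is $$\mathrm{CS}(\mathcal F,\ell,s)=-\operatorname{Res}_{u=0}\frac{\partial_v\alpha(u,0)}{\beta(u,0)}\,du .$$ A foliation $\mathcal H$ of degree $d$ is homogeneous if in suitable affine coordinates $(x,y)$ it is given by $A\,dx+B\,dy$ with $A,B\in\mathbb C[x,y]_d$ and $\gcd(A,B)=1$; $\ell_\infty$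 denotes the line at infinity of these coordinates. Let $\mathcal{CS}(\mathcal F)$ be the set of $\lambda\in\mathbb C\setminus\{0,1\}$ for which there are a line $\ell$ invariant by $\mathcal F$ and a non-degenerate singular point $s\in\ell$ of $\mathcal F$ with $\mathrm{CS}(\mathcal F,\ell,s)=\lambda$. For $d\ge2$ let $\mathcal{CS}_d$ be the set of $\lambda\in\mathbb C\setminus\{0,1\}$ for which there exist two homogeneous convex foliations $\mathcal H,\mathcal H'$ of degree $d$ on $\mathbb P^2_{\mathbb C}$ with singular points $s,s'$ on their respective lines at infinity $\ell_\infty$ such that $\mathrm{CS}(\mathcal H,\ell_\infty,s)=\lambda$ and $\mathrm{CS}(\mathcal H',\ell_\infty,s')=\frac1\lambda$. **Proposition.** Let $\mathcal F$ be a reduced convex foliation of degree $d\ge2$ on $\mathbb P^2_{\mathbb C}$. Then (a) $\emptyset\neq\mathcal{CS}(\mathcal F)\subset\mathcal{CS}_d$; (b) for every $\lambda\in\mathcal{CS}(\mathcal F)$ one has $\frac1\lambda\in\mathcal{CS}(\mathcal F)$. -/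

import Mathlib

open Filter Topology

noncomputable section

/-- Points of the complex projective plane. -/
abbrev PlanePoint : Type := Projectivization ℂ (Fin 3 → ℂ)

/-- Lines of the complex projective plane, as planes through the origin of `ℂ³`. -/
abbrev PlaneLine : Type := {W : Submodule ℂ (Fin 3 → ℂ) // Module.finrank ℂ W = 2}

/-- The point `s` lies on the line `l`. -/
def PlanePoint.OnLine (s : PlanePoint) (l : PlaneLine) : Prop :=
  s.submodule ≤ l.1

/-- A basis `(p, q, m)` of `ℂ³` with `[p] = s`. It gives the affine chart
`(u, v) ↦ [p + u q + v m]` of the projective plane, centred at `s`. -/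
def IsFrameAt (s : PlanePoint) (p q m : Fin 3 → ℂ) : Prop :=
  LinearIndependent ℂ ![p, q, m] ∧ Submodule.span ℂ {p} = s.submodule

/-- `c` is the residue at `a` of the meromorphic germ `f`: the integral of `f` over all
sufficiently small circles around `a` is `2πi c`. -/
def HasResidue (f : ℂ → ℂ) (a c : ℂ) : Prop :=
  ∀ᶠ r in 𝓝[>] (0 : ℝ), (∮ z in C(a, r), f z) = 2 * Real.pi * Complex.I * c

/-- A (holomorphic, singular) foliation of degree `d` on the complex projective plane, given by a
1-form `Ω = Ω₀ dx + Ω₁ dy + Ω₂ dz` whose coefficients are homogeneous polynomials of degree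
`d + 1` without common factor and satisfy the Euler condition `x Ω₀ + y Ω₁ + z Ω₂ = 0`.
Two such forms give the same foliation exactly when they are proportional; nothing defined below
changes when `Ω` is multiplied by a nonzero constant. -/
structure Foliation (d : ℕ) where
  coeff : Fin 3 → MvPolynomial (Fin 3) ℂ
  homogeneous : ∀ i, (coeff i).IsHomogeneous (d + 1)
  euler : ∑ i, MvPolynomial.X i * coeff i = 0
  no_common_factor : ∀ g : MvPolynomial (Fin 3) ℂ, (∀ i, g ∣ coeff i) → IsUnit g

namespace Foliation

variable {d : ℕ}

/-- The value `Ω_x(v)` of the defining form at the point `x` of `ℂ³` on the tangent vector `v`. -/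
def form (F : Foliation d) (x v : Fin 3 → ℂ) : ℂ :=
  ∑ i, MvPolynomial.eval x (F.coeff i) * v i

/-- `s` is a singular point of the foliation. -/
def IsSingular (F : Foliation d) (s : PlanePoint) : Prop :=
  ∀ v, F.form s.rep v = 0

/-- The line `l` is invariant: the defining form restricts to zero on (the cone over) `l`. -/
def IsInvariant (F : Foliation d) (l : PlaneLine) : Prop :=
  ∀ x ∈ l.1, ∀ v ∈ l.1, F.form x v = 0

/-- A foliation of degree `d` is reduced convex if it has `3 d` distinct invariant lines
(the largest possible number when `d ≥ 1`). -/
def IsReducedConvex (F : Foliation d) : Prop :=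
  {l : PlaneLine | F.IsInvariant l}.encard = ((3 * d : ℕ) : ℕ∞)

/-- `γ` is (a lift to `ℂ³` of) a holomorphic immersed germ of curve at `t = 0`, contained in the
leaf through the nonsingular point `[γ 0]`. -/
def IsLeafGerm (F : Foliation d) (γ : ℂ → Fin 3 → ℂ) : Prop :=
  AnalyticAt ℂ γ 0 ∧
  LinearIndependent ℂ ![γ 0, deriv γ 0] ∧
  (∃ v, F.form (γ 0) v ≠ 0) ∧
  ∀ᶠ t in 𝓝 (0 : ℂ), F.form (γ t) (deriv γ t) = 0

/-- A foliation is convex if its leaves other than straight lines have no inflection points: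
if a leaf has an inflection point at `[γ 0]` (the tangent line has contact of order at least 3
there), then that nonsingular point lies on an invariant line, which contains the leaf. -/
def IsConvex (F : Foliation d) : Prop :=
  ∀ γ : ℂ → Fin 3 → ℂ, F.IsLeafGerm γ →
    ¬ LinearIndependent ℂ ![γ 0, deriv γ 0, iteratedDeriv 2 γ 0] →
    ∃ l : PlaneLine, F.IsInvariant l ∧ γ 0 ∈ l.1

/-- The coefficient of `du` of the foliation in the chart `(u, v) ↦ [p + u q + v m]`. -/
def duCoeff (F : Foliation d) (p q m : Fin 3 → ℂ) (u v : ℂ) : ℂ :=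
  F.form (p + u • q + v • m) q

/-- The coefficient of `dv` of the foliation in the chart `(u, v) ↦ [p + u q + v m]`. -/
def dvCoeff (F : Foliation d) (p q m : Fin 3 → ℂ) (u v : ℂ) : ℂ :=
  F.form (p + u • q + v • m) m

/-- `s` is a non-degenerate singular point: in an affine chart centred at `s`, where the foliation
is given by `α du + β dv`, or by the vector field `β ∂/∂u - α ∂/∂v`, the linear part of this vector
field at the origin is invertible. -/
def IsNondegenerateSingular (F : Foliation d) (s : PlanePoint) : Prop :=
  F.IsSingular s ∧ ∃ p q m, IsFrameAt s p q m ∧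
    deriv (fun u => F.duCoeff p q m u 0) 0 * deriv (fun v => F.dvCoeff p q m 0 v) 0 -
      deriv (fun v => F.duCoeff p q m 0 v) 0 * deriv (fun u => F.dvCoeff p q m u 0) 0 ≠ 0

/-- `CS(F, l, s) = c`, for an invariant line `l` through the singular point `s`. In an affine chart
centred at `s` with `l = {v = 0}`, where the foliation is given by `α du + β dv`, the
Camacho-Sad index is the residue at `u = 0` of `-(∂α/∂v)(u, 0) / β(u, 0)`; it does not depend on
the chart. -/
def HasCamachoSadIndex (F : Foliation d) (l : PlaneLine) (s : PlanePoint) (c : ℂ) : Prop :=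
  ∃ p q m, IsFrameAt s p q m ∧ p ∈ l.1 ∧ q ∈ l.1 ∧
    HasResidue (fun u => -(deriv (fun v => F.duCoeff p q m u v) 0 / F.dvCoeff p q m u 0)) 0 c

/-- The set `𝒞𝒮(F)`. -/
def camachoSadSet (F : Foliation d) : Set ℂ :=
  {c | c ≠ 0 ∧ c ≠ 1 ∧ ∃ (l : PlaneLine) (s : PlanePoint), F.IsInvariant l ∧ s.OnLine l ∧
    F.IsNondegenerateSingular s ∧ F.HasCamachoSadIndex l s c}

/-- The foliation is homogeneous with line at infinity `l`: in suitable affine coordinates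
`(x, y) ↦ [x e₀ + y e₁ + e₂]`, for which `l = ⟨e₀, e₁⟩` is the line at infinity, it is given by
`A dx + B dy` with `A, B` homogeneous of degree `d` and `gcd(A, B) = 1`. -/
def IsHomogeneousAt (F : Foliation d) (l : PlaneLine) : Prop :=
  ∃ (e : Fin 3 → Fin 3 → ℂ) (A B : MvPolynomial (Fin 2) ℂ),
    LinearIndependent ℂ e ∧ e 0 ∈ l.1 ∧ e 1 ∈ l.1 ∧
    A.IsHomogeneous d ∧ B.IsHomogeneous d ∧ IsRelPrime A B ∧
    ∀ x y x' y' : ℂ, F.form (x • e 0 + y • e 1 + e 2) (x' • e 0 + y' • e 1) =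
      MvPolynomial.eval ![x, y] A * x' + MvPolynomial.eval ![x, y] B * y'

end Foliation

/-- `c` is the Camacho-Sad index, along the line at infinity, of a homogeneous convex foliation of
degree `d` at one of its singular points on that line. -/
def IsHomogeneousConvexIndex (d : ℕ) (c : ℂ) : Prop :=
  ∃ (H : Foliation d) (l : PlaneLine) (s : PlanePoint), H.IsHomogeneousAt l ∧ H.IsConvex ∧
    s.OnLine l ∧ H.IsSingular s ∧ H.HasCamachoSadIndex l s c

/-- The set `𝒞𝒮_d`. -/
def camachoSadSetOfDegree (d : ℕ) : Set ℂ :=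
  {c | c ≠ 0 ∧ c ≠ 1 ∧ IsHomogeneousConvexIndex d c ∧ IsHomogeneousConvexIndex d (1 / c)}

end

/-! Fix an invariant line `l` with basis `p, q` and a vector `m` outside it, with `q` nonsingular.
Everything is read off the first-order behaviour of Ω along `l`: let A(u), B(u) be the derivatives
in the direction `m` of Ω at `p + u q`, contracted with `p` and `q` (`normalDeriv`). Differentiating
Euler's relation gives A + uB = -Ω(m) at `p + u q`, so A + XB, of degree d + 1, has the singular
points of `l` as its zeros.

The key is a count without slack. If k of the other 3d - 1 invariant lines pass through the point u,
then A + uB (u constant) vanishes there to order at least k (`pow_card_dvd_derivOver`), hence the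
Wronskian W = AB' - A'B vanishes to order at least k - 1, and A + XB vanishes too when k > 0. Since
deg W ≤ 2d - 2 and (d + 1) + (2d - 2) = 3d - 1, these are all the zeros of (A + XB)W, with exact
multiplicities (`IsReducedConvexPair.roots_eq`). It follows that the zeros of A + XB are simple,
that B does not vanish at them, and that W vanishes only at such zeros.

Consequently every singular point of `l` is non-degenerate, has index B/(A + XB)' along `l`, and
lies on a second invariant line. Exchanging the two lines inverts the index, which is (b). The
indices are not all 1: otherwise B = (A + XB)', against the leading coefficients.

For the inclusion in (a), keep only the first-order part of Ω along `l`: with A, B made homogeneous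
in x, y, the form z(A dx + B dy) - (xA + yB) dz defines a homogeneous foliation (`cone`) with the
same indices along `l`. It has no common factor because A and B have no common zero. Off `l` and its
invariant radial lines, a leaf can have an inflection only where W = 0
(`wronskian_eq_zero_of_inflection`); but zeros of W are zeros of A + XB, which lie on invariant
radial lines. So the cone is convex, and the index 1/λ is realized in the same way thanks to (b). -/

noncomputable section

open MvPolynomial (aeval pderiv)

/-! ### Taylor expansion and restriction of polynomials to lines -/

/-- The first order Taylor expansion of a polynomial in a direction. -/
theorem MvPolynomial.exists_aeval_add_mul_eq {σ R : Type*} [Fintype σ] [DecidableEq σ] [CommRing R]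
    [Algebra ℂ R] (x m : σ → R) (r : R) (P : MvPolynomial σ ℂ) :
    ∃ h, aeval (fun i => x i + r * m i) P =
      aeval x P + r * (∑ j, aeval x (pderiv j P) * m j) + r ^ 2 * h := by
  induction P using MvPolynomial.induction_on with
  | C a => exact ⟨0, by simp⟩
  | add P Q hP hQ =>
    obtain ⟨h, hP⟩ := hP
    obtain ⟨k, hQ⟩ := hQ
    refine ⟨h + k, ?_⟩
    simp only [map_add, hP, hQ, add_mul, Finset.sum_add_distrib]
    ring
  | mul_X P i hP =>
    obtain ⟨h, hP⟩ := hP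
    refine ⟨(∑ j, aeval x (pderiv j P) * m j) * m i + h * (x i + r * m i), ?_⟩
    have e : ∑ j, aeval x (pderiv j (P * MvPolynomial.X i)) * m j =
        aeval x P * m i + (∑ j, aeval x (pderiv j P) * m j) * x i := by
      have : ∀ j, aeval x (pderiv j (P * MvPolynomial.X i)) * m j =
          (if j = i then aeval x P * m i else 0) + aeval x (pderiv j P) * m j * x i := by
        intro j
        rw [MvPolynomial.pderiv_mul, MvPolynomial.pderiv_X]
        split_ifs with hj
        · subst hj; simp; ring
        · simp [Ne.symm hj]; ring
      simp only [this, Finset.sum_add_distrib, Finset.sum_mul]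
      simp
    rw [e, map_mul, hP]
    simp only [MvPolynomial.aeval_X, map_mul]
    ring

/-- On a parametrized affine line, a form of degree `n` is a polynomial of degree at most `n` whose
leading coefficient is the value of the form at the direction of the line. -/
theorem natDegree_aeval_le_of_isHomogeneous {P : MvPolynomial (Fin 3) ℂ} {n : ℕ}
    (hP : P.IsHomogeneous n) (a q : Fin 3 → ℂ) :
    (MvPolynomial.aeval (fun i => Polynomial.C (a i) + Polynomial.X * Polynomial.C (q i)) P).natDegree ≤ n ∧
    (MvPolynomial.aeval (fun i => Polynomial.C (a i) + Polynomial.X * Polynomial.C (q i)) P).coeff n =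
      MvPolynomial.aeval q P := by
  have h1 : ∀ i, (Polynomial.C (a i) + Polynomial.X * Polynomial.C (q i)).natDegree ≤ 1 := by
    intro i; compute_degree
  have h2 : ∀ i, (Polynomial.C (a i) + Polynomial.X * Polynomial.C (q i)).coeff 1 = q i := by
    intro i; simp [Polynomial.coeff_C]
  have h3 : ∀ i (k : ℕ),
      ((Polynomial.C (a i) + Polynomial.X * Polynomial.C (q i)) ^ k).natDegree ≤ k := by
    intro i k; simpa using Polynomial.natDegree_pow_le_of_le k (h1 i)
  have h4 : ∀ i (k : ℕ),
      ((Polynomial.C (a i) + Polynomial.X * Polynomial.C (q i)) ^ k).coeff k = q i ^ k := by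
    intro i k; simpa [h2] using Polynomial.coeff_pow_of_natDegree_le (m := k) (h1 i)
  have hs : ∀ s ∈ P.support, s 0 + s 1 + s 2 = n := by
    intro s hs
    have := hP (MvPolynomial.mem_support_iff.1 hs)
    rw [← this, Finsupp.weight_apply, Finsupp.sum_fintype _ _ (by simp)]
    simp [Fin.sum_univ_three]
  rw [MvPolynomial.aeval_def, MvPolynomial.aeval_def, MvPolynomial.eval₂_eq', MvPolynomial.eval₂_eq']
  refine ⟨Polynomial.natDegree_sum_le_of_forall_le _ _ fun s h => ?_, ?_⟩
  · rw [Fin.prod_univ_three]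
    refine (Polynomial.natDegree_C_mul_le _ _).trans ?_
    rw [← hs s h]
    exact Polynomial.natDegree_mul_le_of_le
      (Polynomial.natDegree_mul_le_of_le (h3 _ _) (h3 _ _)) (h3 _ _)
  · rw [Polynomial.finsetSum_coeff]
    refine Finset.sum_congr rfl fun s h => ?_
    rw [Fin.prod_univ_three, Fin.prod_univ_three, ← hs s h]
    rw [show algebraMap ℂ (Polynomial ℂ) (P.coeff s) = Polynomial.C (P.coeff s) from rfl,
      Polynomial.coeff_C_mul,
      Polynomial.coeff_mul_add_eq_of_natDegree_le (Polynomial.natDegree_mul_le_of_le (h3 _ _) (h3 _ _))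
        (h3 _ _), Polynomial.coeff_mul_add_eq_of_natDegree_le (h3 _ _) (h3 _ _), h4, h4, h4]
    rfl

/-! ### The defining form and its first derivative over a ℂ-algebra -/

namespace Foliation

variable {d : ℕ} {R S : Type*} [CommRing R] [Algebra ℂ R] [CommRing S] [Algebra ℂ S]

/-- The defining form of a foliation, evaluated over an arbitrary `ℂ`-algebra. -/
def formOver (F : Foliation d) (x w : Fin 3 → R) : R :=
  ∑ i, aeval x (F.coeff i) * w i

/-- The derivative at `x`, in the direction `m`, of the defining form contracted with `w`. -/
def derivOver (F : Foliation d) (x m w : Fin 3 → R) : R :=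
  ∑ i, (∑ j, aeval x (pderiv j (F.coeff i)) * m j) * w i

variable (F : Foliation d)

theorem form_eq_formOver (x w : Fin 3 → ℂ) : F.form x w = F.formOver x w := rfl

theorem map_formOver (f : R →ₐ[ℂ] S) (x w : Fin 3 → R) :
    f (F.formOver x w) = F.formOver (fun i => f (x i)) (fun i => f (w i)) := by
  simp only [formOver, map_sum, map_mul, ← MvPolynomial.comp_aeval_apply]

theorem map_derivOver (f : R →ₐ[ℂ] S) (x m w : Fin 3 → R) :
    f (F.derivOver x m w) =
      F.derivOver (fun i => f (x i)) (fun i => f (m i)) (fun i => f (w i)) := by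
  simp only [derivOver, map_sum, map_mul, ← MvPolynomial.comp_aeval_apply]

theorem formOver_add (x v w : Fin 3 → R) :
    F.formOver x (v + w) = F.formOver x v + F.formOver x w := by
  simp [formOver, mul_add, Finset.sum_add_distrib]

theorem formOver_smul (x w : Fin 3 → R) (r : R) :
    F.formOver x (r • w) = r * F.formOver x w := by
  simp only [formOver, Finset.mul_sum, Pi.smul_apply, smul_eq_mul]
  exact Finset.sum_congr rfl fun _ _ => by ring

theorem derivOver_add (x m v w : Fin 3 → R) :
    F.derivOver x m (v + w) = F.derivOver x m v + F.derivOver x m w := by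
  simp [derivOver, mul_add, Finset.sum_add_distrib]

theorem derivOver_smul (x m w : Fin 3 → R) (r : R) :
    F.derivOver x m (r • w) = r * F.derivOver x m w := by
  simp only [derivOver, Finset.mul_sum, Pi.smul_apply, smul_eq_mul]
  exact Finset.sum_congr rfl fun _ _ => by ring

theorem derivOver_add_direction (x m n w : Fin 3 → R) :
    F.derivOver x (m + n) w = F.derivOver x m w + F.derivOver x n w := by
  simp [derivOver, mul_add, add_mul, Finset.sum_add_distrib]

theorem derivOver_smul_direction (x m w : Fin 3 → R) (r : R) :
    F.derivOver x (r • m) w = r * F.derivOver x m w := by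
  simp only [derivOver, Finset.mul_sum, Finset.sum_mul, Pi.smul_apply, smul_eq_mul]
  exact Finset.sum_congr rfl fun _ _ => Finset.sum_congr rfl fun _ _ => by ring

theorem formOver_self (x : Fin 3 → R) : F.formOver x x = 0 := by
  have := congrArg (aeval x) F.euler
  simpa [formOver, mul_comm] using this

theorem aeval_smul_of_isHomogeneous {P : MvPolynomial (Fin 3) ℂ} {n : ℕ} (hP : P.IsHomogeneous n)
    (x : Fin 3 → R) (r : R) : aeval (r • x) P = r ^ n * aeval x P := by
  have hs : ∀ s ∈ P.support, s 0 + s 1 + s 2 = n := by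
    intro s hs
    have := hP (MvPolynomial.mem_support_iff.1 hs)
    rw [← this, Finsupp.weight_apply, Finsupp.sum_fintype _ _ (by simp)]
    simp [Fin.sum_univ_three]
  rw [MvPolynomial.aeval_def, MvPolynomial.aeval_def, MvPolynomial.eval₂_eq',
    MvPolynomial.eval₂_eq', Finset.mul_sum]
  refine Finset.sum_congr rfl fun s h => ?_
  rw [Fin.prod_univ_three, Fin.prod_univ_three, ← hs s h]
  simp only [Pi.smul_apply, smul_eq_mul, mul_pow, pow_add]
  ring

theorem formOver_smul_point (x w : Fin 3 → R) (r : R) :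
    F.formOver (r • x) w = r ^ (d + 1) * F.formOver x w := by
  simp only [formOver, aeval_smul_of_isHomogeneous (F.homogeneous _), Finset.mul_sum, mul_assoc]

theorem derivOver_smul_point (x m w : Fin 3 → R) (r : R) :
    F.derivOver (r • x) m w = r ^ d * F.derivOver x m w := by
  simp only [derivOver, aeval_smul_of_isHomogeneous (F.homogeneous _).pderiv, Finset.mul_sum,
    Finset.sum_mul, mul_assoc]
  rfl

theorem exists_formOver_add_smul (x m w : Fin 3 → R) (r : R) :
    ∃ h, F.formOver (x + r • m) w = F.formOver x w + r * F.derivOver x m w + r ^ 2 * h := by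
  choose h hh using fun i => MvPolynomial.exists_aeval_add_mul_eq x m r (F.coeff i)
  refine ⟨∑ i, h i * w i, ?_⟩
  have : x + r • m = fun i => x i + r * m i := rfl
  simp only [formOver, derivOver, this, hh, Finset.mul_sum, ← Finset.sum_add_distrib]
  exact Finset.sum_congr rfl fun i _ => by rw [← Finset.mul_sum]; ring

/-- The complex vector `a`, as a vector with constant coordinates. -/
def constVec (R : Type*) [CommRing R] [Algebra ℂ R] (a : Fin 3 → ℂ) : Fin 3 → R :=
  fun i => algebraMap ℂ R (a i)

theorem map_constVec (f : R →ₐ[ℂ] S) (a : Fin 3 → ℂ) :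
    (fun i => f (constVec R a i)) = constVec S a := by
  ext i; simp [constVec]

theorem constVec_self (a : Fin 3 → ℂ) : constVec ℂ a = a := rfl

theorem eval_formOver (x w : Fin 3 → Polynomial ℂ) (v : ℂ) :
    (F.formOver x w).eval v = F.formOver (fun i => (x i).eval v) (fun i => (w i).eval v) := by
  simpa using F.map_formOver (Polynomial.aeval v) x w

theorem eval_derivOver (x m w : Fin 3 → Polynomial ℂ) (v : ℂ) :
    (F.derivOver x m w).eval v = F.derivOver (fun i => (x i).eval v) (fun i => (m i).eval v)
      (fun i => (w i).eval v) := by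
  simpa using F.map_derivOver (Polynomial.aeval v) x m w

@[simp]
theorem eval_constVec (a : Fin 3 → ℂ) (i : Fin 3) (v : ℂ) :
    (constVec (Polynomial ℂ) a i).eval v = a i := by
  simp [constVec]

/-- This is Euler's relation Ω_x(x) = 0 differentiated in the direction `m`. The increment is taken
to be the indeterminate, so that one factor of it can be cancelled before setting it to 0. -/
theorem derivOver_self_add_formOver (x m : Fin 3 → ℂ) :
    F.derivOver x m x + F.formOver x m = 0 := by
  obtain ⟨h, hh⟩ := F.exists_formOver_add_smul (constVec (Polynomial ℂ) x)
    (constVec (Polynomial ℂ) m)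
    (constVec (Polynomial ℂ) x + (Polynomial.X : Polynomial ℂ) • constVec (Polynomial ℂ) m)
    Polynomial.X
  rw [formOver_self, formOver_add, formOver_self, formOver_smul, derivOver_add, derivOver_smul] at hh
  set X : Polynomial ℂ := Polynomial.X
  have h2 : X * (F.derivOver (constVec (Polynomial ℂ) x) (constVec (Polynomial ℂ) m)
      (constVec (Polynomial ℂ) x) + F.formOver (constVec (Polynomial ℂ) x)
      (constVec (Polynomial ℂ) m) + X * (F.derivOver (constVec (Polynomial ℂ) x)
      (constVec (Polynomial ℂ) m) (constVec (Polynomial ℂ) m) + h)) = 0 := by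
    rw [hh]; ring
  have h3 := (mul_eq_zero.1 h2).resolve_left Polynomial.X_ne_zero
  have h4 := congrArg (Polynomial.eval 0) h3
  simpa [eval_derivOver, eval_formOver, X] using h4

/-- Derivative along a complex affine line. -/
theorem hasDerivAt_form (x m w : Fin 3 → ℂ) :
    HasDerivAt (fun v : ℂ => F.form (x + v • m) w) (F.derivOver x m w) 0 := by
  obtain ⟨h, hh⟩ := F.exists_formOver_add_smul (constVec (Polynomial ℂ) x)
    (constVec (Polynomial ℂ) m) (constVec (Polynomial ℂ) w) Polynomial.X
  have key : ∀ v : ℂ, F.form (x + v • m) w =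
      F.form x w + v * F.derivOver x m w + v ^ 2 * h.eval v := by
    intro v
    have := congrArg (Polynomial.eval v) hh
    simp [eval_derivOver, eval_formOver] at this
    exact this
  have e : (fun v : ℂ => F.form (x + v • m) w) =
      fun v => F.form x w + v * F.derivOver x m w + v ^ 2 * h.eval v := funext key
  rw [e]
  have h1 := (((hasDerivAt_id (0 : ℂ)).mul_const (F.derivOver x m w)).const_add (F.form x w)).add
    (((hasDerivAt_id (0 : ℂ)).pow 2).mul (h.hasDerivAt 0))
  refine (h1.congr_deriv (by simp)).congr_of_eventuallyEq (.of_forall fun v => ?_)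
  simp

end Foliation

/-! ### Counting zeros of A + XB and of the Wronskian along an invariant line -/

namespace Polynomial

theorem le_roots_of_forall_pow_count_dvd {P : ℂ[X]} (hP : P ≠ 0) {M : Multiset ℂ}
    (h : ∀ u ∈ M, (X - C u) ^ M.count u ∣ P) : M ≤ P.roots := by
  rw [Multiset.le_iff_count]
  intro u
  by_cases hu : u ∈ M
  · rw [count_roots, le_rootMultiplicity_iff hP]
    exact h u hu
  · simp [hu]

/-- If the Wronskian of `A` and `B` vanishes and `A` has smaller degree than `B`, then `A = 0`. -/
theorem eq_zero_of_wronskian_eq_zero {A B : ℂ[X]} (hdeg : A.natDegree < B.natDegree)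
    (hW : A * derivative B - derivative A * B = 0) : A = 0 := by
  by_contra hA
  have hB : B ≠ 0 := by rintro rfl; simp at hdeg
  have hB' : (derivative B).natDegree ≤ B.natDegree - 1 := natDegree_derivative_le B
  have hA' : (derivative A).natDegree ≤ A.natDegree - 1 := natDegree_derivative_le A
  obtain ⟨b, hb⟩ : ∃ b, B.natDegree = b + 1 := ⟨B.natDegree - 1, by omega⟩
  -- In degree deg A + deg B - 1 the Wronskian has coefficient lc(A) lc(B) (deg B - deg A), which is
  -- nonzero.
  have h1 : (A * derivative B).coeff (A.natDegree + b) =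
      A.leadingCoeff * (B.leadingCoeff * (b + 1)) := by
    rw [coeff_mul_add_eq_of_natDegree_le le_rfl (by omega), coeff_derivative, ← hb]
    rfl
  have h2 : (derivative A * B).coeff (A.natDegree + b) =
      A.leadingCoeff * A.natDegree * B.leadingCoeff := by
    rcases Nat.eq_zero_or_pos A.natDegree with h0 | h0
    · rw [derivative_of_natDegree_zero h0]; simp [h0]
    · obtain ⟨a, ha⟩ : ∃ a, A.natDegree = a + 1 := ⟨A.natDegree - 1, by omega⟩
      rw [show A.natDegree + b = a + B.natDegree by omega,
        coeff_mul_add_eq_of_natDegree_le (by omega) le_rfl, coeff_derivative, ← ha]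
      rw [leadingCoeff, leadingCoeff, ha]
      push_cast
      ring
  have h3 := congrArg (fun p => coeff p (A.natDegree + b)) hW
  simp only [coeff_sub, h1, h2, coeff_zero] at h3
  have h4 : A.leadingCoeff * B.leadingCoeff * ((b + 1 : ℂ) - A.natDegree) = 0 := by
    rw [← h3]; ring
  have h5 : ((b + 1 : ℕ) : ℂ) - (A.natDegree : ℂ) ≠ 0 := by
    rw [sub_ne_zero]; exact_mod_cast (by omega : b + 1 ≠ A.natDegree)
  push_cast at h5
  simp [hA, hB, h5] at h4

/-- Numerical data of a foliation of degree `d` along an invariant line: `M` lists the points where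
the other `3 d - 1` invariant lines meet it. -/
structure IsReducedConvexPair (d : ℕ) (A B : ℂ[X]) (M : Multiset ℂ) : Prop where
  two_le : 2 ≤ d
  natDegree_left : A.natDegree ≤ d
  natDegree_right : B.natDegree = d
  card_eq : M.card = 3 * d - 1
  dvd : ∀ u, (X - C u) ^ M.count u ∣ A + C u * B
  count_le : ∀ u, M.count u ≤ d

namespace IsReducedConvexPair

variable {d : ℕ} {A B : ℂ[X]} {M : Multiset ℂ}

/-- The Wronskian is unchanged when a constant multiple of B is added to A. This allows A to be
replaced by the combination that vanishes to high order at a given point, or by one of degree less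
than d. -/
theorem wronskian_eq (A B : ℂ[X]) (u : ℂ) : A * derivative B - derivative A * B =
    (A + C u * B) * derivative B - derivative (A + C u * B) * B := by
  simp; ring

theorem right_ne_zero (h : IsReducedConvexPair d A B M) : B ≠ 0 := by
  rintro rfl
  have := h.natDegree_right
  have := h.two_le
  simp at *
  omega

theorem exists_natDegree_lt (h : IsReducedConvexPair d A B M) :
    ∃ c, (A + C c * B).natDegree < d := by
  have hd := h.two_le
  have hb : B.coeff d ≠ 0 := by
    rw [← h.natDegree_right]; simpa using h.right_ne_zero
  refine ⟨-A.coeff d / B.coeff d, ?_⟩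
  have h3 : (A + C (-A.coeff d / B.coeff d) * B).coeff d = 0 := by
    simp [hb]
  generalize -A.coeff d / B.coeff d = c at h3 ⊢
  have h1 : (A + C c * B).natDegree ≤ d :=
    (natDegree_add_le_of_degree_le h.natDegree_left
      ((natDegree_C_mul_le _ _).trans h.natDegree_right.le))
  refine lt_of_le_of_ne h1 fun h2 => ?_
  conv at h3 => lhs; rw [← h2]
  rw [ coeff_natDegree, leadingCoeff_eq_zero] at h3
  rw [h3] at h2
  simp at h2
  omega

/-- If W = 0, then A = -cB for a constant c, so A + uB = (u - c)B. All points of `M` other than c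
are then zeros of B, at most d of them with multiplicity; c itself counts at most d times. This
gives 3d - 1 ≤ 2d, impossible for d ≥ 2. -/
theorem wronskian_ne_zero (h : IsReducedConvexPair d A B M) :
    A * derivative B - derivative A * B ≠ 0 := by
  intro hW
  have hd := h.two_le
  obtain ⟨c, hc⟩ := h.exists_natDegree_lt
  rw [wronskian_eq A B c] at hW
  have h0 := eq_zero_of_wronskian_eq_zero (by rwa [h.natDegree_right]) hW
  have h1 : M.filter (· ≠ c) ≤ B.roots := by
    refine le_roots_of_forall_pow_count_dvd h.right_ne_zero fun u hu => ?_
    have huc : u ≠ c := (Multiset.mem_filter.1 hu).2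
    rw [Multiset.count_filter_of_pos (p := (· ≠ c)) huc]
    have h2 := h.dvd u
    have h3 : A + C u * B = C (u - c) * B := by
      rw [C_sub]; linear_combination h0
    rw [h3] at h2
    exact ((isUnit_C.2 (sub_ne_zero.2 huc).isUnit).dvd_mul_left).1 h2
  have h4 := (Multiset.card_le_card h1).trans (card_roots' B)
  have h5 := congrArg Multiset.card (Multiset.filter_add_not (· = c) M)
  rw [Multiset.card_add, Multiset.filter_eq', Multiset.card_replicate, h.card_eq] at h5
  have h6 := h.count_le c
  rw [h.natDegree_right] at h4
  simp only [ne_eq] at h4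
  omega

/-- The naive bound 2d - 1 drops by one after a multiple of B is added to A to cancel its
coefficient of degree d. -/
theorem natDegree_wronskian_le (h : IsReducedConvexPair d A B M) :
    (A * derivative B - derivative A * B).natDegree ≤ 2 * d - 2 := by
  have hd := h.two_le
  obtain ⟨c, hc⟩ := h.exists_natDegree_lt
  rw [wronskian_eq A B c]
  have h1 := natDegree_derivative_le (A + C c * B)
  have h2 := natDegree_derivative_le B
  have h3 := h.natDegree_right
  refine (natDegree_sub_le _ _).trans (max_le ?_ ?_)
  · refine natDegree_mul_le.trans ?_
    omega
  · refine natDegree_mul_le.trans ?_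
    omega

theorem coeff_eq (h : IsReducedConvexPair d A B M) :
    (A + X * B).coeff (d + 1) = B.coeff d := by
  rw [coeff_add, coeff_X_mul, coeff_eq_zero_of_natDegree_lt (Nat.lt_succ_of_le h.natDegree_left),
    zero_add]

theorem natDegree_eq (h : IsReducedConvexPair d A B M) : (A + X * B).natDegree = d + 1 := by
  refine natDegree_eq_of_le_of_coeff_ne_zero ?_ ?_
  · refine natDegree_add_le_of_degree_le (h.natDegree_left.trans (by omega)) ?_
    refine natDegree_mul_le.trans ?_
    rw [natDegree_X, h.natDegree_right, add_comm]
  · rw [h.coeff_eq, ← h.natDegree_right]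
    simpa using h.right_ne_zero

theorem ne_zero (h : IsReducedConvexPair d A B M) : A + X * B ≠ 0 := by
  intro h0
  have := h.natDegree_eq
  simp [h0] at this

theorem pow_sub_one_dvd_wronskian (h : IsReducedConvexPair d A B M) (u : ℂ) :
    (X - C u) ^ (M.count u - 1) ∣ A * derivative B - derivative A * B := by
  rw [wronskian_eq A B u]
  exact dvd_sub (((pow_dvd_pow _ (Nat.sub_le _ _)).trans (h.dvd u)).mul_right _)
    ((pow_sub_one_dvd_derivative_of_pow_dvd (h.dvd u)).mul_right _)

theorem eval_eq_zero_of_mem (h : IsReducedConvexPair d A B M) {u : ℂ} (hu : u ∈ M) :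
    (A + X * B).eval u = 0 := by
  have h1 := (dvd_pow_self (X - C u) (Multiset.count_ne_zero.2 hu)).trans (h.dvd u)
  rw [dvd_iff_isRoot, IsRoot] at h1
  simpa using h1

/-- The invariant lines account for all the zeros of the inflection divisor. -/
theorem roots_eq (h : IsReducedConvexPair d A B M) :
    M = ((A + X * B) * (A * derivative B - derivative A * B)).roots := by
  have hd := h.two_le
  refine Multiset.eq_of_le_of_card_le
    (le_roots_of_forall_pow_count_dvd (mul_ne_zero h.ne_zero h.wronskian_ne_zero) fun u hu => ?_) ?_
  · have h1 : X - C u ∣ A + X * B := dvd_iff_isRoot.2 (h.eval_eq_zero_of_mem hu)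
    have h2 := mul_dvd_mul h1 (h.pow_sub_one_dvd_wronskian u)
    rwa [mul_pow_sub_one (Multiset.count_ne_zero.2 hu)] at h2
  · refine (card_roots' _).trans (natDegree_mul_le.trans ?_)
    have := h.natDegree_wronskian_le
    rw [h.natDegree_eq, h.card_eq]
    omega

theorem count_eq (h : IsReducedConvexPair d A B M) (u : ℂ) :
    M.count u = (A + X * B).rootMultiplicity u +
      (A * derivative B - derivative A * B).rootMultiplicity u := by
  conv_lhs => rw [h.roots_eq]
  rw [count_roots, rootMultiplicity_mul (mul_ne_zero h.ne_zero h.wronskian_ne_zero)]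

theorem mem_of_eval_eq_zero (h : IsReducedConvexPair d A B M) {u : ℂ}
    (hu : (A + X * B).eval u = 0) : u ∈ M := by
  have h1 := (rootMultiplicity_pos h.ne_zero).2 hu
  have h2 := h.count_eq u
  exact Multiset.count_pos.1 (by omega)

theorem eval_eq_zero_of_wronskian (h : IsReducedConvexPair d A B M) {u : ℂ}
    (hu : (A * derivative B - derivative A * B).eval u = 0) : (A + X * B).eval u = 0 := by
  have h1 := (rootMultiplicity_pos h.wronskian_ne_zero).2 hu
  have h2 := h.count_eq u
  exact h.eval_eq_zero_of_mem (Multiset.count_pos.1 (by omega))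

/-- The count of u in `M` is the sum of its multiplicities in A + XB and in W; the latter is at
least the count minus one, so the former is at most one. -/
theorem eval_derivative_ne_zero (h : IsReducedConvexPair d A B M) {u : ℂ}
    (hu : (A + X * B).eval u = 0) : (derivative (A + X * B)).eval u ≠ 0 := by
  intro h0
  have h1 := (one_lt_rootMultiplicity_iff_isRoot h.ne_zero).2 ⟨hu, h0⟩
  have h2 := h.count_eq u
  have h3 := (le_rootMultiplicity_iff h.wronskian_ne_zero).2 (h.pow_sub_one_dvd_wronskian u)
  omega

/-- If B(u) = 0, the term (A + uB)'B regains the factor lost by differentiation, so W vanishes at u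
to the full order given by `M`. That leaves no multiplicity for the zero of A + XB. -/
theorem eval_right_ne_zero (h : IsReducedConvexPair d A B M) {u : ℂ}
    (hu : (A + X * B).eval u = 0) : B.eval u ≠ 0 := by
  intro h0
  have h1 := (rootMultiplicity_pos h.ne_zero).2 hu
  have h2 := h.count_eq u
  have h3 : (X - C u) ^ M.count u ∣ A * derivative B - derivative A * B := by
    rw [wronskian_eq A B u]
    refine dvd_sub ((h.dvd u).mul_right _) ?_
    have h4 := mul_dvd_mul (pow_sub_one_dvd_derivative_of_pow_dvd (h.dvd u))
      (dvd_iff_isRoot.2 h0)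
    rwa [pow_sub_one_mul (by omega)] at h4
  have h4 := (le_rootMultiplicity_iff h.wronskian_ne_zero).2 h3
  omega

/-- By comparison of leading coefficients, the indices cannot all be equal to `1`. -/
theorem exists_eval_ne (h : IsReducedConvexPair d A B M) :
    ∃ u, (A + X * B).eval u = 0 ∧ B.eval u ≠ (derivative (A + X * B)).eval u := by
  have hd := h.two_le
  by_contra! hall
  have hnodup : (A + X * B).roots.Nodup := by
    rw [Multiset.nodup_iff_count_le_one]
    intro u
    rw [count_roots]
    by_contra! h1
    have := (one_lt_rootMultiplicity_iff_isRoot h.ne_zero).1 h1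
    exact h.eval_derivative_ne_zero this.1 this.2
  have hcard : (A + X * B).roots.toFinset.card = d + 1 := by
    rw [Multiset.toFinset_card_of_nodup hnodup, ← h.natDegree_eq]
    exact (IsAlgClosed.splits _).natDegree_eq_card_roots.symm
  have h1 := natDegree_derivative_le (A + X * B)
  rw [h.natDegree_eq] at h1
  -- Both polynomials have degree at most d and agree at the d + 1 distinct zeros of A + XB.
  have h0 : B - derivative (A + X * B) = 0 := by
    refine eq_zero_of_natDegree_lt_card_of_eval_eq_zero' _ (A + X * B).roots.toFinset
      (fun u hu => ?_) ?_
    · rw [Multiset.mem_toFinset, mem_roots h.ne_zero] at hu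
      rw [eval_sub, hall u hu, sub_self]
    · rw [hcard]
      have := natDegree_sub_le B (derivative (A + X * B))
      have h2 := h.natDegree_right
      have := max_le (a := B.natDegree) (c := d) h2.le (by omega : _ ≤ d)
      omega
  have h2 := congrArg (fun p => coeff p d) h0
  simp only [coeff_sub, coeff_derivative, h.coeff_eq, coeff_zero] at h2
  have hb : B.coeff d ≠ 0 := by
    rw [← h.natDegree_right]; simpa using h.right_ne_zero
  have h3 : B.coeff d * d = 0 := by linear_combination -h2
  rcases mul_eq_zero.1 h3 with h4 | h4
  · exact hb h4
  · have : d = 0 := by exact_mod_cast h4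
    omega

end IsReducedConvexPair

end Polynomial

/-! ### Linear algebra of lines -/

theorem linearIndependent_triple_iff {p q m : Fin 3 → ℂ} :
    LinearIndependent ℂ ![p, q, m] ↔
      ∀ a b c : ℂ, a • p + b • q + c • m = 0 → a = 0 ∧ b = 0 ∧ c = 0 := by
  rw [Fintype.linearIndependent_iff]
  constructor
  · intro h a b c habc
    have := h ![a, b, c] (by simpa [Fin.sum_univ_three] using habc)
    exact ⟨this 0, this 1, this 2⟩
  · intro h g hg
    have := h (g 0) (g 1) (g 2) (by simpa [Fin.sum_univ_three] using hg)
    intro i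
    fin_cases i
    exacts [this.1, this.2.1, this.2.2]

/-- The basis of `ℂ³` given by three independent vectors. -/
def tripleBasis {p q m : Fin 3 → ℂ} (h : LinearIndependent ℂ ![p, q, m]) :
    Module.Basis (Fin 3) ℂ (Fin 3 → ℂ) :=
  basisOfLinearIndependentOfCardEqFinrank h (by simp)

theorem coe_tripleBasis {p q m : Fin 3 → ℂ} (h : LinearIndependent ℂ ![p, q, m]) :
    ⇑(tripleBasis h) = ![p, q, m] := by
  simp [tripleBasis]

theorem exists_eq_of_linearIndependent {p q m : Fin 3 → ℂ} (h : LinearIndependent ℂ ![p, q, m])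
    (w : Fin 3 → ℂ) : ∃ a b c : ℂ, w = a • p + b • q + c • m := by
  have := (tripleBasis h).sum_repr w
  rw [Fin.sum_univ_three, coe_tripleBasis] at this
  exact ⟨_, _, _, this.symm⟩

namespace PlaneLine

/-- The line spanned by two independent vectors. -/
def through (v w : Fin 3 → ℂ) (h : LinearIndependent ℂ ![v, w]) : PlaneLine :=
  ⟨Submodule.span ℂ {v, w}, by
    have := finrank_span_eq_card h
    rwa [Matrix.range_cons, Matrix.range_cons, Matrix.range_empty, Set.union_empty,
      Set.singleton_union, Fintype.card_fin] at this⟩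

theorem mem_through {v w : Fin 3 → ℂ} {h : LinearIndependent ℂ ![v, w]} {x : Fin 3 → ℂ} :
    x ∈ (through v w h).1 ↔ ∃ a b : ℂ, a • v + b • w = x :=
  Submodule.mem_span_pair

theorem eq_through {l : PlaneLine} {v w : Fin 3 → ℂ} (h : LinearIndependent ℂ ![v, w])
    (hv : v ∈ l.1) (hw : w ∈ l.1) : l = through v w h := by
  refine Subtype.ext (Submodule.eq_of_le_of_finrank_eq ?_ ?_).symm
  · exact Submodule.span_le.2 (by rintro x (rfl | rfl) <;> assumption)
  · rw [l.2, (through v w h).2]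

theorem exists_add_smul_mem (l : PlaneLine) {q : Fin 3 → ℂ} (hq : q ∉ l.1) (v : Fin 3 → ℂ) :
    ∃ c : ℂ, v + c • q ∈ l.1 := by
  have h1 : Module.finrank ℂ ((Fin 3 → ℂ) ⧸ l.1) = 1 := by
    have := l.1.finrank_quotient_add_finrank
    rw [l.2] at this
    simpa using this
  have h2 : l.1.mkQ q ≠ 0 := by simpa using hq
  obtain ⟨c, hc⟩ := (finrank_eq_one_iff_of_nonzero' _ h2).1 h1 (l.1.mkQ v)
  refine ⟨-c, ?_⟩
  rw [← Submodule.Quotient.mk_eq_zero]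
  rw [← map_smul] at hc
  have : l.1.mkQ (v + (-c) • q) = 0 := by
    rw [map_add, ← hc, ← map_add, ← add_smul]; simp
  exact this

theorem exists_mem_notMem {l l' : PlaneLine} (h : l ≠ l') : ∃ v ∈ l'.1, v ∉ l.1 := by
  by_contra! hall
  exact h (Subtype.ext (Submodule.eq_of_le_of_finrank_eq hall (by rw [l.2, l'.2])).symm)

theorem linearIndependent_pair_of_triple {p q m : Fin 3 → ℂ}
    (h : LinearIndependent ℂ ![p, q, m]) : LinearIndependent ℂ ![p, q] := by
  rw [LinearIndependent.pair_iff]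
  intro a b hab
  have := linearIndependent_triple_iff.1 h a b 0 (by simpa using hab)
  exact ⟨this.1, this.2.1⟩

theorem exists_eq_of_mem {l : PlaneLine} {p q m : Fin 3 → ℂ}
    (h : LinearIndependent ℂ ![p, q, m]) (hp : p ∈ l.1) (hq : q ∈ l.1) {w : Fin 3 → ℂ}
    (hw : w ∈ l.1) : ∃ a b : ℂ, w = a • p + b • q := by
  rw [eq_through (linearIndependent_pair_of_triple h) hp hq, mem_through] at hw
  obtain ⟨a, b, rfl⟩ := hw
  exact ⟨a, b, rfl⟩

theorem notMem_of_triple {l : PlaneLine} {p q m : Fin 3 → ℂ}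
    (h : LinearIndependent ℂ ![p, q, m]) (hp : p ∈ l.1) (hq : q ∈ l.1) : m ∉ l.1 := by
  intro hm
  obtain ⟨a, b, hab⟩ := exists_eq_of_mem h hp hq hm
  have := linearIndependent_triple_iff.1 h a b (-1) (by rw [hab]; module)
  simpa using this.2.2

/-- Two independent vectors of a line and a vector outside it form a basis. -/
theorem linearIndependent_triple {l : PlaneLine} {p q m : Fin 3 → ℂ}
    (h : LinearIndependent ℂ ![p, q]) (hp : p ∈ l.1) (hq : q ∈ l.1) (hm : m ∉ l.1) :
    LinearIndependent ℂ ![p, q, m] := by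
  rw [linearIndependent_triple_iff]
  intro a b c habc
  have hc : c = 0 := by
    by_contra hc
    refine hm ?_
    have : m = (-(a / c)) • p + (-(b / c)) • q := by
      have h1 : c • m = (-a) • p + (-b) • q := by
        rw [← sub_eq_zero, ← habc]; module
      have h2 := congrArg (fun x => c⁻¹ • x) h1
      simp only [smul_smul, inv_mul_cancel₀ hc, one_smul, smul_add] at h2
      rw [h2]
      congr 2 <;> ring
    rw [this]
    exact add_mem (l.1.smul_mem _ hp) (l.1.smul_mem _ hq)
  subst hc
  have := LinearIndependent.pair_iff.1 h a b (by simpa using habc)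
  exact ⟨this.1, this.2, rfl⟩

end PlaneLine

namespace Foliation

variable {d : ℕ} (F : Foliation d)

/-! ### Invariant lines through a point -/

/-- The form kills the directions of both lines, and together these span ℂ³. -/
theorem form_eq_zero_of_mem_of_mem {F : Foliation d} {l l' : PlaneLine} (hl : F.IsInvariant l)
    (hl' : F.IsInvariant l') (hne : l ≠ l') {x : Fin 3 → ℂ} (hx : x ∈ l.1) (hx' : x ∈ l'.1)
    (w : Fin 3 → ℂ) : F.form x w = 0 := by
  obtain ⟨v, hv', hv⟩ := PlaneLine.exists_mem_notMem hne
  obtain ⟨c, hc⟩ := l.exists_add_smul_mem hv w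
  have h1 := hl x hx _ hc
  have h2 := hl' x hx' v hv'
  rw [form_eq_formOver] at *
  rwa [formOver_add, formOver_smul, h2, mul_zero, add_zero] at h1

/-- Away from `v`, the plane of the line is spanned by the point itself, killed by Euler's relation,
and by `v`. -/
theorem isInvariant_through {v w : Fin 3 → ℂ} (h : LinearIndependent ℂ ![v, w])
    (hv : ∀ y, F.form v y = 0) (hvw : ∀ a b : ℂ, b ≠ 0 → F.form (a • v + b • w) v = 0) :
    F.IsInvariant (PlaneLine.through v w h) := by
  intro x hx y hy
  obtain ⟨a, b, rfl⟩ := PlaneLine.mem_through.1 hx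
  obtain ⟨a', b', rfl⟩ := PlaneLine.mem_through.1 hy
  by_cases hb : b = 0
  · subst hb
    have := hv (a' • v + b' • w)
    rw [form_eq_formOver] at *
    rw [zero_smul, add_zero, formOver_smul_point, this, mul_zero]
  · have h1 := hvw a b hb
    have h2 := F.formOver_self (a • v + b • w)
    rw [form_eq_formOver] at *
    have h3 : a' • v + b' • w = (b' / b) • (a • v + b • w) + (a' - b' / b * a) • v := by
      have : b' = b' / b * b := by field_simp
      conv_lhs => rw [this]
      module
    rw [h3, formOver_add, formOver_smul, formOver_smul, h1, h2]
    simp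

/-- The defining form restricted to a parametrized line has degree at most `d + 1`. -/
theorem natDegree_formOver_le (a q w : Fin 3 → ℂ) :
    (F.formOver (constVec (Polynomial ℂ) a + (Polynomial.X : Polynomial ℂ) •
      constVec (Polynomial ℂ) q) (constVec (Polynomial ℂ) w)).natDegree ≤ d + 1 ∧
    (F.formOver (constVec (Polynomial ℂ) a + (Polynomial.X : Polynomial ℂ) •
      constVec (Polynomial ℂ) q) (constVec (Polynomial ℂ) w)).coeff (d + 1) = F.formOver q w := by
  have h := fun i => natDegree_aeval_le_of_isHomogeneous (F.homogeneous i) a q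
  constructor
  · refine Polynomial.natDegree_sum_le_of_forall_le _ _ fun i _ => ?_
    exact (Polynomial.natDegree_mul_C_le _ _).trans (h i).1
  · rw [formOver, Polynomial.finsetSum_coeff]
    refine Finset.sum_congr rfl fun i _ => ?_
    rw [← (h i).2]
    exact Polynomial.coeff_mul_C _ _ _

theorem natDegree_derivOver_le (a q m w : Fin 3 → ℂ) :
    (F.derivOver (constVec (Polynomial ℂ) a + (Polynomial.X : Polynomial ℂ) •
      constVec (Polynomial ℂ) q) (constVec (Polynomial ℂ) m)
      (constVec (Polynomial ℂ) w)).natDegree ≤ d ∧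
    (F.derivOver (constVec (Polynomial ℂ) a + (Polynomial.X : Polynomial ℂ) •
      constVec (Polynomial ℂ) q) (constVec (Polynomial ℂ) m)
      (constVec (Polynomial ℂ) w)).coeff d = F.derivOver q m w := by
  have h := fun i j => natDegree_aeval_le_of_isHomogeneous
    ((F.homogeneous i).pderiv (i := j)) a q
  simp only [Nat.add_sub_cancel] at h
  constructor
  · refine Polynomial.natDegree_sum_le_of_forall_le _ _ fun i _ => ?_
    refine (Polynomial.natDegree_mul_C_le _ _).trans ?_
    refine Polynomial.natDegree_sum_le_of_forall_le _ _ fun j _ => ?_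
    exact (Polynomial.natDegree_mul_C_le _ _).trans (h i j).1
  · rw [derivOver, Polynomial.finsetSum_coeff]
    refine Finset.sum_congr rfl fun i _ => ?_
    refine (Polynomial.coeff_mul_C _ _ _).trans ?_
    rw [Polynomial.finsetSum_coeff]
    congr 1
    refine Finset.sum_congr rfl fun j _ => ?_
    rw [← (h i j).2]
    exact Polynomial.coeff_mul_C _ _ _

/-- If more than `d + 1` invariant lines pass through a point, then all lines through it are
invariant. -/
theorem form_eq_zero_of_lt_card {p q m : Fin 3 → ℂ} (hq : F.form q p = 0) {T : Finset ℂ}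
    (hcard : d < T.card) (hT : ∀ t ∈ T, ∀ a b : ℂ, F.form (a • p + b • (m + t • q)) p = 0)
    (a t : ℂ) {b : ℂ} (hb : b ≠ 0) : F.form (a • p + b • (m + t • q)) p = 0 := by
  obtain ⟨h1, h2⟩ := F.natDegree_formOver_le (a • p + b • m) q p
  have heval : ∀ s : ℂ, (F.formOver (constVec (Polynomial ℂ) (a • p + b • m) +
      (Polynomial.X : Polynomial ℂ) • constVec (Polynomial ℂ) q)
      (constVec (Polynomial ℂ) p)).eval (b * s) = F.form (a • p + b • (m + s • q)) p := by
    intro s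
    rw [eval_formOver, form_eq_formOver]
    congr 1 <;> ext i <;> simp
    ring
  have h3 := Polynomial.eq_zero_of_natDegree_lt_card_of_eval_eq_zero' _ (T.image (b * ·))
    (fun x hx => by
      obtain ⟨s, hs, rfl⟩ := Finset.mem_image.1 hx
      rw [heval]
      exact hT s hs a b)
    (by
      rw [Finset.card_image_of_injective _ (mul_right_injective₀ hb)]
      -- The coefficient of degree d + 1 is Ω_q(p) = 0, so d + 1 zeros are enough.
      have h4 := Polynomial.natDegree_le_pred h1 (h2.trans hq)
      omega)
  rw [← heval, h3, Polynomial.eval_zero]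

/-- The normal derivative of the form along an invariant line vanishes at a point of that line to
the order given by the number of other invariant lines through the point. -/
theorem pow_card_dvd_derivOver {p q m : Fin 3 → ℂ} (hpq : ∀ x : ℂ, F.form (p + x • q) p = 0)
    {T : Finset ℂ} (hT : ∀ t ∈ T, ∀ v : ℂ, F.form (p + v • (m + t • q)) p = 0) :
    (Polynomial.X : Polynomial ℂ) ^ T.card ∣
      F.derivOver (constVec (Polynomial ℂ) p + (Polynomial.X : Polynomial ℂ) •
        constVec (Polynomial ℂ) q) (constVec _ m) (constVec _ p) := by
  -- In ℂ[v][u] the outer variable u moves along `q` and the inner variable v along `m`. Since Ω(p)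
  -- vanishes on the line v = 0, it is v times some D whose value at v = 0 is the normal derivative.
  let x₀ : Fin 3 → (Polynomial (Polynomial ℂ)) := constVec (Polynomial (Polynomial ℂ)) p + (Polynomial.X : (Polynomial (Polynomial ℂ))) • constVec (Polynomial (Polynomial ℂ)) q
  obtain ⟨h, hh⟩ := F.exists_formOver_add_smul x₀ (constVec (Polynomial (Polynomial ℂ)) m) (constVec (Polynomial (Polynomial ℂ)) p)
    (Polynomial.C Polynomial.X)
  have h0 : F.formOver x₀ (constVec (Polynomial (Polynomial ℂ)) p) = 0 := by
    have h1 : F.formOver (constVec (Polynomial ℂ) p + (Polynomial.X : Polynomial ℂ) •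
        constVec (Polynomial ℂ) q) (constVec (Polynomial ℂ) p) = 0 := by
      refine Polynomial.funext fun v => ?_
      rw [eval_formOver, Polynomial.eval_zero, ← hpq v, form_eq_formOver]
      congr 1 <;> ext i <;> simp
    let e : Polynomial ℂ →ₐ[ℂ] (Polynomial (Polynomial ℂ)) := Polynomial.mapAlgHom (Algebra.ofId ℂ (Polynomial ℂ))
    have h2 := F.map_formOver e
      (constVec (Polynomial ℂ) p + (Polynomial.X : Polynomial ℂ) •
        constVec (Polynomial ℂ) q) (constVec (Polynomial ℂ) p)
    rw [h1, map_zero, map_constVec] at h2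
    rw [h2]
    congr 1
    ext1 i
    have h3 : e Polynomial.X = Polynomial.X := by simp [e]
    have h4 := fun a => congrFun (map_constVec e a) i
    simp only [Pi.add_apply, Pi.smul_apply, smul_eq_mul, map_add, map_mul, h3, h4, x₀]
  rw [h0, zero_add] at hh
  set D : (Polynomial (Polynomial ℂ)) := F.derivOver x₀ (constVec (Polynomial (Polynomial ℂ)) m) (constVec (Polynomial (Polynomial ℂ)) p) + Polynomial.C Polynomial.X * h with hD
  have hfact : F.formOver (x₀ + (Polynomial.C Polynomial.X : (Polynomial (Polynomial ℂ))) • constVec (Polynomial (Polynomial ℂ)) m) (constVec (Polynomial (Polynomial ℂ)) p) =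
      Polynomial.C Polynomial.X * D := by rw [hh, hD]; ring
  -- Each invariant line p + v(m + tq) is u = tv in these coordinates, and makes u - tv a factor of
  -- D.
  have hroot : ∀ t ∈ T, D.eval (Polynomial.C t * Polynomial.X) = 0 := by
    intro t ht
    let ev : (Polynomial (Polynomial ℂ)) →ₐ[ℂ] Polynomial ℂ :=
      (Polynomial.aeval (R := Polynomial ℂ) (Polynomial.C t * Polynomial.X)).restrictScalars ℂ
    have hev : ∀ P : (Polynomial (Polynomial ℂ)), ev P = P.eval (Polynomial.C t * Polynomial.X) := fun P => by
      simp [ev, Polynomial.coe_aeval_eq_eval]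
    have h1 := congrArg ev hfact
    rw [map_formOver, map_mul, hev (Polynomial.C Polynomial.X), Polynomial.eval_C, hev D] at h1
    refine (mul_eq_zero.1 (h1.symm.trans ?_)).resolve_left Polynomial.X_ne_zero
    refine Polynomial.funext fun v => ?_
    rw [eval_formOver, Polynomial.eval_zero, ← hT t ht v, form_eq_formOver]
    congr 1 <;> ext i <;> simp [hev, x₀, constVec]
    ring
  have hdvd : ∏ t ∈ T, (Polynomial.X - Polynomial.C (Polynomial.C t * Polynomial.X) : (Polynomial (Polynomial ℂ))) ∣ D := by
    rcases eq_or_ne D 0 with h0 | h0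
    · rw [h0]; exact dvd_zero _
    have h1 := (Multiset.prod_X_sub_C_dvd_iff_le_roots h0
      (T.val.map fun t => Polynomial.C t * Polynomial.X)).2 ?_
    · rwa [Multiset.map_map] at h1
    · refine (Multiset.le_iff_subset ?_).2 fun x hx => ?_
      · refine T.nodup.map fun s t hst => ?_
        exact Polynomial.C_injective (mul_right_cancel₀ Polynomial.X_ne_zero hst)
      · obtain ⟨t, ht, rfl⟩ := Multiset.mem_map.1 hx
        exact (Polynomial.mem_roots h0).2 (hroot t ht)
  -- Setting v = 0 turns each factor u - tv into u.
  let f : (Polynomial (Polynomial ℂ)) →ₐ[ℂ] Polynomial ℂ := Polynomial.mapAlgHom (Polynomial.aeval (0 : ℂ))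
  have h1 := map_dvd f hdvd
  have h2 : f (∏ t ∈ T, (Polynomial.X - Polynomial.C (Polynomial.C t * Polynomial.X) : (Polynomial (Polynomial ℂ)))) =
      Polynomial.X ^ T.card := by
    rw [map_prod, ← Finset.prod_const]
    refine Finset.prod_congr rfl fun t _ => ?_
    simp [f]
  have h3 : f D = F.derivOver (constVec (Polynomial ℂ) p + (Polynomial.X : Polynomial ℂ) •
        constVec (Polynomial ℂ) q) (constVec _ m) (constVec _ p) := by
    rw [hD, map_add, map_mul, map_derivOver]
    have : f (Polynomial.C Polynomial.X) = 0 := by simp [f]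
    rw [this, zero_mul, add_zero, map_constVec, map_constVec]
    congr 1
    ext1 i
    have h3 : f Polynomial.X = Polynomial.X := by simp [f]
    have h4 := fun a => congrFun (map_constVec f a) i
    simp only [Pi.add_apply, Pi.smul_apply, smul_eq_mul, map_add, map_mul, h3, h4, x₀]
  rwa [h2, h3] at h1

end Foliation

namespace Foliation

variable {d : ℕ} (F : Foliation d)

/-! ### Nonsingular points on an invariant line -/

/-- A linear functional on `ℂ³`, as a polynomial. -/
def linearPoly (φ : (Fin 3 → ℂ) →ₗ[ℂ] ℂ) : MvPolynomial (Fin 3) ℂ :=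
  ∑ i, MvPolynomial.C (φ (Pi.single i 1)) * MvPolynomial.X i

theorem aeval_linearPoly {R : Type*} [CommRing R] [Algebra ℂ R] (φ : (Fin 3 → ℂ) →ₗ[ℂ] ℂ)
    (x : Fin 3 → R) :
    MvPolynomial.aeval x (linearPoly φ) = ∑ i, algebraMap ℂ R (φ (Pi.single i 1)) * x i := by
  simp [linearPoly]

theorem eval_linearPoly (φ : (Fin 3 → ℂ) →ₗ[ℂ] ℂ) (x : Fin 3 → ℂ) :
    MvPolynomial.eval x (linearPoly φ) = φ x := by
  rw [φ.pi_apply_eq_sum_univ x]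
  simp only [linearPoly, map_sum, map_mul, MvPolynomial.eval_C, MvPolynomial.eval_X, smul_eq_mul]
  refine Finset.sum_congr rfl fun i _ => ?_
  rw [mul_comm]
  congr 2
  ext j
  simp [Pi.single_apply, eq_comm]

theorem isHomogeneous_linearPoly (φ : (Fin 3 → ℂ) →ₗ[ℂ] ℂ) : (linearPoly φ).IsHomogeneous 1 :=
  MvPolynomial.IsHomogeneous.sum _ _ _ fun i _ => by
    simpa using (MvPolynomial.isHomogeneous_C (Fin 3) (φ (Pi.single i 1))).mul
      (MvPolynomial.isHomogeneous_X ℂ i)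

/-- A polynomial vanishing on the kernel of a linear functional is divisible by it. -/
theorem linearPoly_dvd {φ : (Fin 3 → ℂ) →ₗ[ℂ] ℂ} {m : Fin 3 → ℂ} (hm : φ m = 1)
    {P : MvPolynomial (Fin 3) ℂ} (hP : ∀ x, φ x = 0 → MvPolynomial.eval x P = 0) :
    linearPoly φ ∣ P := by
  let π : MvPolynomial (Fin 3) ℂ →ₐ[ℂ] MvPolynomial (Fin 3) ℂ :=
    MvPolynomial.aeval fun i => MvPolynomial.X i - linearPoly φ * MvPolynomial.C (m i)
  let I : Ideal (MvPolynomial (Fin 3) ℂ) := Ideal.span {linearPoly φ}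
  -- The substitution π is the projection of ℂ³ onto the kernel of φ along `m`. It is the identity
  -- modulo φ, and it kills `P`.
  have h1 : (Ideal.Quotient.mkₐ ℂ I).comp π = Ideal.Quotient.mkₐ ℂ I := by
    refine MvPolynomial.algHom_ext fun i => ?_
    have h2 : Ideal.Quotient.mkₐ ℂ I (linearPoly φ) = 0 :=
      Ideal.Quotient.eq_zero_iff_mem.2 (Ideal.mem_span_singleton_self _)
    simp only [AlgHom.comp_apply, π, MvPolynomial.aeval_X, map_sub, map_mul, h2, zero_mul, sub_zero]
  have h3 : π P = 0 := by
    refine MvPolynomial.funext fun x => ?_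
    have h4 : MvPolynomial.eval x (π P) = MvPolynomial.eval (x - φ x • m) P := by
      have := MvPolynomial.comp_aeval_apply
        (fun i => MvPolynomial.X i - linearPoly φ * MvPolynomial.C (m i))
        (MvPolynomial.aeval (R := ℂ) x) P
      rw [MvPolynomial.aeval_eq_eval, MvPolynomial.aeval_eq_eval] at this
      refine this.trans ?_
      congr 2
      ext i
      simp [eval_linearPoly]
    rw [h4, map_zero]
    exact hP _ (by simp [hm])
  rw [← Ideal.mem_span_singleton, ← Ideal.Quotient.eq_zero_iff_mem]
  have := DFunLike.congr_fun h1 P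
  rw [AlgHom.comp_apply, h3, map_zero] at this
  exact this.symm

/-- Otherwise Ω would vanish at every point of `l`, and the linear equation of `l` would divide all
its coefficients. -/
theorem exists_form_ne_zero {F : Foliation d} {l : PlaneLine} (hl : F.IsInvariant l)
    {p q m : Fin 3 → ℂ} (hind : LinearIndependent ℂ ![p, q, m]) (hp : p ∈ l.1) (hq : q ∈ l.1) :
    ∃ t : ℂ, F.form (q + t • p) m ≠ 0 := by
  by_contra! hall
  have h1 : ∀ x ∈ l.1, F.form x m = 0 := by
    have hq' : ∀ a b : ℂ, a ≠ 0 → F.form (a • q + b • p) m = 0 := by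
      intro a b ha
      have h2 := hall (b / a)
      have h3 : a • q + b • p = a • (q + (b / a) • p) := by
        rw [smul_add, smul_smul, mul_div_cancel₀ _ ha]
      rw [form_eq_formOver] at *
      rw [h3, formOver_smul_point, h2, mul_zero]
    have hp' : ∀ b : ℂ, F.form (b • p) m = 0 := by
      -- The excluded point is recovered by a polynomial identity: a polynomial vanishing at every
      -- nonzero s vanishes at 0.
      intro b
      have h3 : F.formOver (constVec (Polynomial ℂ) (b • p) +
          (Polynomial.X : Polynomial ℂ) • constVec (Polynomial ℂ) q)
          (constVec (Polynomial ℂ) m) = 0 := by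
        refine Polynomial.eq_zero_of_infinite_isRoot _ ?_
        refine (Set.Finite.infinite_compl (Set.finite_singleton (0 : ℂ))).mono fun s hs => ?_
        have h4 := hq' s b (by simpa using hs)
        rw [Set.mem_ofPred_eq, Polynomial.IsRoot, eval_formOver, ← h4, form_eq_formOver]
        congr 1 <;> ext i <;> simp
        ring
      have h4 := congrArg (Polynomial.eval 0) h3
      rw [eval_formOver, Polynomial.eval_zero] at h4
      rw [← h4, form_eq_formOver]
      congr 1 <;> ext i <;> simp
    intro x hx
    obtain ⟨b, a, rfl⟩ := PlaneLine.exists_eq_of_mem hind hp hq hx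
    by_cases ha : a = 0
    · subst ha; simpa using hp' b
    · rw [add_comm]; exact hq' a b ha
  have h2 : ∀ x ∈ l.1, ∀ w, F.form x w = 0 := by
    intro x hx w
    obtain ⟨c, hc⟩ := l.exists_add_smul_mem (PlaneLine.notMem_of_triple hind hp hq) w
    have h3 := hl x hx _ hc
    have h4 := h1 x hx
    rw [form_eq_formOver] at *
    rwa [formOver_add, formOver_smul, h4, mul_zero, add_zero] at h3
  have hb := coe_tripleBasis hind
  set B := tripleBasis hind
  have hB2 : B 2 = m := by rw [hb]; rfl
  have hB1 : B 1 = q := by rw [hb]; rfl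
  have hB0 : B 0 = p := by rw [hb]; rfl
  have hker : ∀ x, B.coord 2 x = 0 → x ∈ l.1 := by
    intro x hx
    rw [Module.Basis.coord_apply] at hx
    rw [← B.sum_repr x, Fin.sum_univ_three, hx, hB0, hB1, zero_smul, add_zero]
    exact add_mem (l.1.smul_mem _ hp) (l.1.smul_mem _ hq)
  have hunit := F.no_common_factor (linearPoly (B.coord 2)) fun i => by
    refine linearPoly_dvd (m := m) (by rw [← hB2]; simp) fun x hx => ?_
    have := h2 x (hker x hx) (Pi.single i 1)
    simpa [form, Pi.single_apply] using this
  have h5 := hunit.map (MvPolynomial.eval p)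
  rw [eval_linearPoly, ← hB0] at h5
  simp at h5

/-! ### The other invariant lines along an invariant line -/

/-- The normal derivative along the line through `p` and `q`, contracted with `w`, as a
polynomial in the affine coordinate `u` of `p + u q`. -/
def normalDeriv (p q m w : Fin 3 → ℂ) : Polynomial ℂ :=
  F.derivOver (constVec (Polynomial ℂ) p + (Polynomial.X : Polynomial ℂ) •
    constVec (Polynomial ℂ) q) (constVec _ m) (constVec _ w)

theorem eval_normalDeriv (p q m w : Fin 3 → ℂ) (u : ℂ) :
    (F.normalDeriv p q m w).eval u = F.derivOver (p + u • q) m w := by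
  rw [normalDeriv, eval_derivOver]
  congr 1 <;> ext i <;> simp

theorem normalDeriv_add_smul (p q m v w : Fin 3 → ℂ) (a : ℂ) :
    F.normalDeriv p q m (v + a • w) = F.normalDeriv p q m v +
      Polynomial.C a * F.normalDeriv p q m w := by
  refine Polynomial.funext fun u => ?_
  simp only [Polynomial.eval_add, Polynomial.eval_mul, Polynomial.eval_C, eval_normalDeriv,
    derivOver_add, derivOver_smul]

theorem eval_normalDeriv_add (p q m : Fin 3 → ℂ) (u : ℂ) :
    (F.normalDeriv p q m p + Polynomial.X * F.normalDeriv p q m q).eval u =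
      - F.form (p + u • q) m := by
  rw [Polynomial.eval_add, Polynomial.eval_mul, Polynomial.eval_X, eval_normalDeriv,
    eval_normalDeriv, ← derivOver_smul, ← derivOver_add, eq_neg_iff_add_eq_zero]
  exact F.derivOver_self_add_formOver _ _

theorem infinite_isInvariant {p q m : Fin 3 → ℂ} (hind : LinearIndependent ℂ ![p, q, m])
    (hp : ∀ y, F.form p y = 0)
    (h : ∀ a b t : ℂ, b ≠ 0 → F.form (a • p + b • (m + t • q)) p = 0) :
    {l : PlaneLine | F.IsInvariant l}.Infinite := by
  have hind' : ∀ t : ℂ, LinearIndependent ℂ ![p, m + t • q] := by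
    intro t
    rw [LinearIndependent.pair_iff]
    intro a b hab
    have := linearIndependent_triple_iff.1 hind a (b * t) b (by rw [← hab]; module)
    exact ⟨this.1, this.2.2⟩
  refine Set.infinite_of_injective_forall_mem
    (f := fun t : ℂ => PlaneLine.through p (m + t • q) (hind' t)) ?_ fun t =>
      F.isInvariant_through (hind' t) hp fun a b hb => h a b t hb
  intro s t hst
  have h1 : m + s • q ∈ (PlaneLine.through p (m + t • q) (hind' t)).1 := by
    refine (SetLike.ext_iff.1 (congrArg Subtype.val hst) _).1 ?_
    exact PlaneLine.mem_through.2 ⟨0, 1, by simp⟩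
  obtain ⟨a, b, hab⟩ := PlaneLine.mem_through.1 h1
  have h2 := linearIndependent_triple_iff.1 hind a (b * t - s) (b - 1) (by
    rw [← sub_eq_zero] at hab; rw [← hab]; module)
  have h3 := sub_eq_zero.1 h2.2.2
  have h4 := h2.2.1
  rw [h3, one_mul, sub_eq_zero] at h4
  exact h4.symm

/-- As `q` is nonsingular, no other invariant line contains it. Each of them therefore meets `l` at
a unique p + uq, contains a unique m + tq, and is determined by (u, t); `M` collects the values u.
-/
theorem exists_isReducedConvexPair {F : Foliation d} (hd : 2 ≤ d) (hF : F.IsReducedConvex)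
    {l : PlaneLine} (hl : F.IsInvariant l) {p q m : Fin 3 → ℂ}
    (hind : LinearIndependent ℂ ![p, q, m]) (hp : p ∈ l.1) (hq : q ∈ l.1)
    (hns : F.form q m ≠ 0) :
    ∃ M : Multiset ℂ, Polynomial.IsReducedConvexPair d (F.normalDeriv p q m p)
      (F.normalDeriv p q m q) M ∧
      ∀ u ∈ M, ∃ l' : PlaneLine, l' ≠ l ∧ F.IsInvariant l' ∧ p + u • q ∈ l'.1 := by
  classical
  have hfin : {l : PlaneLine | F.IsInvariant l}.Finite :=
    Set.finite_of_encard_eq_coe hF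
  have hcardI : {l : PlaneLine | F.IsInvariant l}.ncard = 3 * d := by
    rw [Set.ncard, hF]; rfl
  let S : Finset PlaneLine := hfin.toFinset.erase l
  have hS : ∀ l', l' ∈ S ↔ l' ≠ l ∧ F.IsInvariant l' := by
    intro l'; simp [S]
  have hScard : S.card = 3 * d - 1 := by
    rw [Finset.card_erase_of_mem (by simpa using hl), ← Set.ncard_eq_toFinset_card _ hfin, hcardI]
  have hqS : ∀ l' ∈ S, q ∉ l'.1 := fun l' hl' hq' =>
    hns (form_eq_zero_of_mem_of_mem hl ((hS l').1 hl').2 ((hS l').1 hl').1.symm hq hq' m)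
  have hch : ∀ v : Fin 3 → ℂ, ∃ f : PlaneLine → ℂ, ∀ l' ∈ S, v + f l' • q ∈ l'.1 := by
    intro v
    have : ∀ l' : PlaneLine, ∃ c : ℂ, l' ∈ S → v + c • q ∈ l'.1 := fun l' => by
      by_cases h : l' ∈ S
      · obtain ⟨c, hc⟩ := l'.exists_add_smul_mem (hqS l' h) v
        exact ⟨c, fun _ => hc⟩
      · exact ⟨0, fun h' => absurd h' h⟩
    choose f hf using this
    exact ⟨f, hf⟩
  obtain ⟨u, hu⟩ := hch p
  obtain ⟨t, ht⟩ := hch m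
  have hind2 : ∀ a b : ℂ, LinearIndependent ℂ ![p + a • q, m + b • q] := by
    intro a b
    rw [LinearIndependent.pair_iff]
    intro x y hxy
    have := linearIndependent_triple_iff.1 hind x (x * a + y * b) y (by rw [← hxy]; module)
    exact ⟨this.1, this.2.2⟩
  have hind3 : ∀ a : ℂ, LinearIndependent ℂ ![p + a • q, q, m] := by
    intro a
    rw [linearIndependent_triple_iff]
    intro x y z hxyz
    have := linearIndependent_triple_iff.1 hind x (x * a + y) z (by rw [← hxyz]; module)
    obtain ⟨rfl, h2, h3⟩ := this
    exact ⟨rfl, by simpa using h2, h3⟩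
  have hpa : ∀ a : ℂ, p + a • q ∈ l.1 := fun a => add_mem hp (l.1.smul_mem _ hq)
  let T : ℂ → Finset ℂ := fun a => (S.filter fun l' => a = u l').image t
  have hTcard : ∀ a, (T a).card = (S.val.map u).count a := by
    intro a
    rw [Multiset.count_map, Finset.card_image_of_injOn]
    · rfl
    · intro l₁ h₁ l₂ h₂ h12
      simp only [Finset.coe_filter, Set.mem_ofPred_eq] at h₁ h₂
      rw [PlaneLine.eq_through (hind2 (u l₁) (t l₁)) (hu _ h₁.1) (ht _ h₁.1),
        PlaneLine.eq_through (hind2 (u l₁) (t l₁)) (v := p + u l₁ • q) (w := m + t l₁ • q)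
          (l := l₂) (by rw [← h₁.2, h₂.2]; exact hu _ h₂.1) (by rw [h12]; exact ht _ h₂.1)]
  have hTform : ∀ a, ∀ s ∈ T a, ∀ x y : ℂ,
      F.form (x • (p + a • q) + y • (m + s • q)) (p + a • q) = 0 := by
    intro a s hs x y
    obtain ⟨l', hl', rfl⟩ := Finset.mem_image.1 hs
    obtain ⟨h1, rfl⟩ := Finset.mem_filter.1 hl'
    exact ((hS l').1 h1).2 _ (add_mem (l'.1.smul_mem _ (hu _ h1)) (l'.1.smul_mem _ (ht _ h1))) _
      (hu _ h1)
  have hmem : ∀ a ∈ S.val.map u,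
      ∃ l' : PlaneLine, l' ≠ l ∧ F.IsInvariant l' ∧ p + a • q ∈ l'.1 := by
    intro a ha
    obtain ⟨l', hl', rfl⟩ := Multiset.mem_map.1 ha
    exact ⟨l', ((hS l').1 hl').1, ((hS l').1 hl').2, hu l' hl'⟩
  refine ⟨S.val.map u, ⟨hd, (F.natDegree_derivOver_le _ _ _ _).1, ?_, ?_, ?_, ?_⟩, hmem⟩
  -- The coefficient of degree d of B is the normal derivative at `q` contracted with `q`, which is
  -- -Ω_q(m) ≠ 0.
  · refine Polynomial.natDegree_eq_of_le_of_coeff_ne_zero (F.natDegree_derivOver_le _ _ _ _).1 ?_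
    rw [normalDeriv, (F.natDegree_derivOver_le _ _ _ _).2]
    intro h0
    have := F.derivOver_self_add_formOver q m
    rw [h0, zero_add] at this
    exact hns this
  · rw [Multiset.card_map]; exact hScard
  · intro a
    have h1 := F.pow_card_dvd_derivOver (p := p + a • q) (q := q) (m := m) (T := T a)
      (fun x => hl _ (add_mem (hpa a) (l.1.smul_mem _ hq)) _ (hpa a))
      (fun s hs v => by simpa using hTform a s hs 1 v)
    -- Substituting X - a moves the base point of the parametrization from p + aq back to p.
    have h2 := map_dvd (Polynomial.aeval (R := ℂ) (Polynomial.X - Polynomial.C a)) h1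
    rw [map_pow, Polynomial.aeval_X, hTcard] at h2
    rw [← normalDeriv_add_smul]
    refine h2.trans (dvd_of_eq ?_)
    rw [map_derivOver, map_constVec, map_constVec, normalDeriv]
    congr 1
    ext1 i
    simp [constVec]
    ring
  · intro a
    -- More than d invariant lines besides `l` through one point would make the whole pencil there
    -- invariant, against the finite number of invariant lines.
    by_contra! hlt
    rw [← hTcard] at hlt
    obtain ⟨l', h1, h2, h3⟩ := hmem a (Multiset.count_pos.1 (by rw [← hTcard]; omega))
    refine F.infinite_isInvariant (hind3 a)
      (form_eq_zero_of_mem_of_mem h2 hl h1 h3 (hpa a)) ?_ hfin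
    intro x y s hy
    exact F.form_eq_zero_of_lt_card (hl _ hq _ (hpa a)) hlt (hTform a) x s hy

end Foliation

/-! ### Binary forms without common zeros -/

namespace MvPolynomial

theorem isRelPrime_X_pow {σ : Type*} {i j : σ} (hij : i ≠ j) (a b : ℕ) :
    IsRelPrime (X i ^ a : MvPolynomial σ ℂ) (X j ^ b) := by
  classical
  refine IsRelPrime.pow ((X_prime (R := ℂ) (i := i)).irreducible.isRelPrime_iff_not_dvd.2 ?_)
  rintro ⟨c, hc⟩
  have := congrArg (eval (Pi.single j 1)) hc
  simp [hij] at this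

variable {A B : MvPolynomial (Fin 2) ℂ}

/-- Hilbert's Nullstellensatz: the coordinates vanish on the common zero locus, which is contained
in the origin. -/
theorem exists_X_pow_mem_span (h : ∀ x, eval x A = 0 → eval x B = 0 → x = 0) (i : Fin 2) :
    ∃ n, (X i ^ n : MvPolynomial (Fin 2) ℂ) ∈ Ideal.span {A, B} := by
  have h1 : (X i : MvPolynomial (Fin 2) ℂ) ∈
      vanishingIdeal ℂ (zeroLocus ℂ (Ideal.span {A, B})) := by
    rw [mem_vanishingIdeal_iff]
    intro x hx
    rw [mem_zeroLocus_iff] at hx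
    have hA := hx A (Ideal.subset_span (by simp))
    have hB := hx B (Ideal.subset_span (by simp))
    rw [aeval_eq_eval] at hA hB
    rw [aeval_X, h x hA hB]
    rfl
  rwa [vanishingIdeal_zeroLocus_eq_radical] at h1

theorem isRelPrime_of_forall_eval (h : ∀ x, eval x A = 0 → eval x B = 0 → x = 0) :
    IsRelPrime A B := by
  intro g hA hB
  obtain ⟨m, hm⟩ := exists_X_pow_mem_span h 0
  obtain ⟨n, hn⟩ := exists_X_pow_mem_span h 1
  have hle : Ideal.span {A, B} ≤ Ideal.span {g} := by
    rw [Ideal.span_le]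
    rintro x (rfl | rfl)
    exacts [Ideal.mem_span_singleton.2 hA, Ideal.mem_span_singleton.2 hB]
  exact isRelPrime_X_pow (by decide) m n (Ideal.mem_span_singleton.1 (hle hm))
    (Ideal.mem_span_singleton.1 (hle hn))

/-- The coefficients of a homogeneous foliation have no common factor. -/
theorem isUnit_of_dvd_cone (h : ∀ x, eval x A = 0 → eval x B = 0 → x = 0)
    (hC : ∃ x, x 0 * eval x A + x 1 * eval x B ≠ 0) {g : MvPolynomial (Fin 3) ℂ}
    (hA : g ∣ X 2 * aeval ![X 0, X 1] A) (hB : g ∣ X 2 * aeval ![X 0, X 1] B)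
    (hAB : g ∣ X 0 * aeval ![X 0, X 1] A + X 1 * aeval ![X 0, X 1] B) : IsUnit g := by
  have hX2 : ¬ (X 2 : MvPolynomial (Fin 3) ℂ) ∣
      X 0 * aeval ![X 0, X 1] A + X 1 * aeval ![X 0, X 1] B := by
    rintro ⟨c, hc⟩
    obtain ⟨x, hx⟩ := hC
    have h1 : ∀ P : MvPolynomial (Fin 2) ℂ,
        eval ![x 0, x 1, 0] (aeval ![X 0, X 1] P : MvPolynomial (Fin 3) ℂ) = eval x P := by
      intro P
      have := comp_aeval_apply (![X 0, X 1] : Fin 2 → MvPolynomial (Fin 3) ℂ)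
        (aeval (R := ℂ) ![x 0, x 1, 0]) P
      rw [aeval_eq_eval, aeval_eq_eval] at this
      refine this.trans ?_
      congr 2
      ext i
      fin_cases i <;> simp
    have h2 := congrArg (eval ![x 0, x 1, 0]) hc
    simp only [map_add, map_mul, h1, eval_X] at h2
    simp at h2
    exact hx h2
  by_contra hg
  have hg0 : g ≠ 0 := by
    rintro rfl
    exact hX2 ((zero_dvd_iff.1 hAB).symm ▸ dvd_zero _)
  obtain ⟨r, hr, hrg⟩ := WfDvdMonoid.exists_irreducible_factor hg hg0
  have hprime : Prime r := hr.prime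
  -- An irreducible common factor is either z, excluded by xA + yB ≠ 0 on z = 0, or a common factor
  -- of A and B, which then divides powers of both x and y.
  by_cases hr2 : r ∣ X 2
  · exact hX2 ((hr.dvd_symm (X_prime (i := 2)).irreducible hr2).trans (hrg.trans hAB))
  have hA' := (hprime.dvd_or_dvd (hrg.trans hA)).resolve_left hr2
  have hB' := (hprime.dvd_or_dvd (hrg.trans hB)).resolve_left hr2
  have hpow : ∀ i, ∃ n, r ∣ (aeval ![X 0, X 1] (X i ^ n : MvPolynomial (Fin 2) ℂ) :
      MvPolynomial (Fin 3) ℂ) := by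
    intro i
    obtain ⟨n, hn⟩ := exists_X_pow_mem_span h i
    obtain ⟨a, b, hab⟩ := Ideal.mem_span_pair.1 hn
    refine ⟨n, ?_⟩
    rw [← hab, map_add, map_mul, map_mul]
    exact dvd_add (hA'.mul_left _) (hB'.mul_left _)
  obtain ⟨m, hm⟩ := hpow 0
  obtain ⟨n, hn⟩ := hpow 1
  simp only [map_pow, aeval_X] at hm hn
  exact hr.not_isUnit (isRelPrime_X_pow (by decide : (0 : Fin 3) ≠ 1) m n hm hn)

end MvPolynomial

namespace Foliation

variable {d : ℕ} (F : Foliation d)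

/-! ### The homogeneous foliation obtained by degeneration along a line -/

/-- The normal derivative along the plane spanned by `p` and `q`, in homogeneous coordinates. -/
def normalForm {R : Type*} [CommRing R] [Algebra ℂ R] (p q m : Fin 3 → ℂ) (x y : R)
    (w : Fin 3 → ℂ) : R :=
  F.derivOver (x • constVec R p + y • constVec R q) (constVec R m) (constVec R w)

theorem map_normalForm {R S : Type*} [CommRing R] [Algebra ℂ R] [CommRing S] [Algebra ℂ S]
    (f : R →ₐ[ℂ] S) (p q m : Fin 3 → ℂ) (x y : R) (w : Fin 3 → ℂ) :
    f (F.normalForm p q m x y w) = F.normalForm p q m (f x) (f y) w := by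
  rw [normalForm, map_derivOver, map_constVec, map_constVec, normalForm]
  congr 1
  ext i
  have h4 := fun a => congrFun (map_constVec f a) i
  simp only [Pi.add_apply, Pi.smul_apply, smul_eq_mul, map_add, map_mul, h4]

theorem isHomogeneous_normalForm {σ : Type*} (p q m : Fin 3 → ℂ) {x y : MvPolynomial σ ℂ}
    (hx : x.IsHomogeneous 1) (hy : y.IsHomogeneous 1) (w : Fin 3 → ℂ) :
    (F.normalForm p q m x y w).IsHomogeneous d := by
  have hC : ∀ a (i : Fin 3), (constVec (MvPolynomial σ ℂ) a i).IsHomogeneous 0 := fun a i =>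
    MvPolynomial.isHomogeneous_C σ (a i)
  refine MvPolynomial.IsHomogeneous.sum _ _ _ fun i _ => ?_
  refine MvPolynomial.IsHomogeneous.mul (m := d) (n := 0)
    (MvPolynomial.IsHomogeneous.sum _ _ _ fun j _ => ?_) (hC _ _)
  refine MvPolynomial.IsHomogeneous.mul (m := d) (n := 0) ?_ (hC _ _)
  have := ((F.homogeneous i).pderiv (i := j)).aeval
    (x • constVec (MvPolynomial σ ℂ) p + y • constVec (MvPolynomial σ ℂ) q) (n := 1)
    (fun k => by
      have h1 := (hx.mul (hC p k)).add (hy.mul (hC q k))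
      simpa using h1)
  simpa using this

theorem eval_normalForm {σ : Type*} (p q m : Fin 3 → ℂ) (x y : MvPolynomial σ ℂ)
    (w : Fin 3 → ℂ) (s : σ → ℂ) : MvPolynomial.eval s (F.normalForm p q m x y w) =
      F.derivOver (MvPolynomial.eval s x • p + MvPolynomial.eval s y • q) m w := by
  have := F.map_normalForm (MvPolynomial.aeval (R := ℂ) s) p q m x y w
  rwa [MvPolynomial.aeval_eq_eval] at this

variable {p q m : Fin 3 → ℂ}

/-- The coefficients of the homogeneous foliation. -/
def coneCoeff (h : LinearIndependent ℂ ![p, q, m]) (i : Fin 3) : MvPolynomial (Fin 3) ℂ :=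
  linearPoly ((tripleBasis h).coord 2) *
      (F.normalForm p q m (linearPoly ((tripleBasis h).coord 0))
        (linearPoly ((tripleBasis h).coord 1)) p *
          MvPolynomial.C ((tripleBasis h).coord 0 (Pi.single i 1)) +
       F.normalForm p q m (linearPoly ((tripleBasis h).coord 0))
        (linearPoly ((tripleBasis h).coord 1)) q *
          MvPolynomial.C ((tripleBasis h).coord 1 (Pi.single i 1))) -
    (linearPoly ((tripleBasis h).coord 0) *
      F.normalForm p q m (linearPoly ((tripleBasis h).coord 0))
        (linearPoly ((tripleBasis h).coord 1)) p +
     linearPoly ((tripleBasis h).coord 1) *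
      F.normalForm p q m (linearPoly ((tripleBasis h).coord 0))
        (linearPoly ((tripleBasis h).coord 1)) q) *
      MvPolynomial.C ((tripleBasis h).coord 2 (Pi.single i 1))

theorem sum_coneCoeff_mul (h : LinearIndependent ℂ ![p, q, m]) {R : Type*} [CommRing R]
    [Algebra ℂ R] (x w : Fin 3 → R) :
    ∑ i, MvPolynomial.aeval x (F.coneCoeff h i) * w i =
      MvPolynomial.aeval x (linearPoly ((tripleBasis h).coord 2)) *
      (F.normalForm p q m (MvPolynomial.aeval x (linearPoly ((tripleBasis h).coord 0)))
        (MvPolynomial.aeval x (linearPoly ((tripleBasis h).coord 1))) p *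
          MvPolynomial.aeval w (linearPoly ((tripleBasis h).coord 0)) +
       F.normalForm p q m (MvPolynomial.aeval x (linearPoly ((tripleBasis h).coord 0)))
        (MvPolynomial.aeval x (linearPoly ((tripleBasis h).coord 1))) q *
          MvPolynomial.aeval w (linearPoly ((tripleBasis h).coord 1))) -
    (MvPolynomial.aeval x (linearPoly ((tripleBasis h).coord 0)) *
      F.normalForm p q m (MvPolynomial.aeval x (linearPoly ((tripleBasis h).coord 0)))
        (MvPolynomial.aeval x (linearPoly ((tripleBasis h).coord 1))) p +
     MvPolynomial.aeval x (linearPoly ((tripleBasis h).coord 1)) *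
      F.normalForm p q m (MvPolynomial.aeval x (linearPoly ((tripleBasis h).coord 0)))
        (MvPolynomial.aeval x (linearPoly ((tripleBasis h).coord 1))) q) *
      MvPolynomial.aeval w (linearPoly ((tripleBasis h).coord 2)) := by
  rw [aeval_linearPoly _ w, aeval_linearPoly _ w, aeval_linearPoly _ w]
  simp only [coneCoeff, map_sub, map_add, map_mul, map_normalForm, MvPolynomial.aeval_C]
  simp only [mul_add, sub_mul, add_mul, Finset.sum_add_distrib, Finset.sum_sub_distrib,
    Finset.mul_sum]
  congr 1
  · congr 1 <;> exact Finset.sum_congr rfl fun i _ => by ring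
  · congr 1 <;> exact Finset.sum_congr rfl fun i _ => by ring

theorem coord_tripleBasis (h : LinearIndependent ℂ ![p, q, m]) (a b c : ℂ) :
    (tripleBasis h).coord 0 (a • p + b • q + c • m) = a ∧
    (tripleBasis h).coord 1 (a • p + b • q + c • m) = b ∧
    (tripleBasis h).coord 2 (a • p + b • q + c • m) = c := by
  have hb := coe_tripleBasis h
  set B := tripleBasis h
  have h2 : m = B 2 := by rw [hb]; rfl
  have h1 : q = B 1 := by rw [hb]; rfl
  have h0 : p = B 0 := by rw [hb]; rfl
  rw [h0, h1, h2]
  refine ⟨?_, ?_, ?_⟩ <;> simp [-Module.Basis.repr_self, Module.Basis.repr_self_apply]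

theorem isHomogeneous_coneCoeff (h : LinearIndependent ℂ ![p, q, m]) (i : Fin 3) :
    (F.coneCoeff h i).IsHomogeneous (d + 1) := by
  rw [coneCoeff]
  have hL := fun k => isHomogeneous_linearPoly ((tripleBasis h).coord k)
  have hN := F.isHomogeneous_normalForm p q m (hL 0) (hL 1)
  have hC := MvPolynomial.isHomogeneous_C (R := ℂ) (Fin 3)
  refine MvPolynomial.IsHomogeneous.sub ?_ ?_
  · have := (hL 2).mul (((hN p).mul (hC ((tripleBasis h).coord 0 (Pi.single i 1)))).add
      ((hN q).mul (hC ((tripleBasis h).coord 1 (Pi.single i 1)))))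
    exact (show 1 + (d + 0) = d + 1 by omega) ▸ this
  · have := (((hL 0).mul (hN p)).add ((hL 1).mul (hN q))).mul
      (hC ((tripleBasis h).coord 2 (Pi.single i 1)))
    exact (show 1 + d + 0 = d + 1 by omega) ▸ this

theorem euler_coneCoeff (h : LinearIndependent ℂ ![p, q, m]) :
    ∑ i, MvPolynomial.X i * F.coneCoeff h i = 0 := by
  have := F.sum_coneCoeff_mul h (MvPolynomial.X : Fin 3 → MvPolynomial (Fin 3) ℂ) MvPolynomial.X
  simp only [MvPolynomial.aeval_X_left, AlgHom.id_apply] at this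
  simp only [mul_comm (MvPolynomial.X _)]
  rw [this]
  ring

theorem isUnit_of_dvd_coneCoeff (h : LinearIndependent ℂ ![p, q, m])
    (hAB : ∀ x y : ℂ, F.derivOver (x • p + y • q) m p = 0 →
      F.derivOver (x • p + y • q) m q = 0 → x = 0 ∧ y = 0)
    (hC : ∃ x y : ℂ, F.derivOver (x • p + y • q) m (x • p + y • q) ≠ 0)
    {g : MvPolynomial (Fin 3) ℂ} (hg : ∀ i, g ∣ F.coneCoeff h i) : IsUnit g := by
  -- Coordinates in the basis `p, q, m`, with inverse substitution `y` below. Contracting the form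
  -- with `p, q, m` yields zA, zB and -(xA + yB).
  let x : Fin 3 → MvPolynomial (Fin 3) ℂ := fun i => MvPolynomial.C (p i) * MvPolynomial.X 0 +
    MvPolynomial.C (q i) * MvPolynomial.X 1 + MvPolynomial.C (m i) * MvPolynomial.X 2
  have hx : ∀ s, (fun i => MvPolynomial.eval s (x i)) = s 0 • p + s 1 • q + s 2 • m := by
    intro s; ext i; simp [x]; ring
  have hxL : ∀ k, MvPolynomial.aeval x (linearPoly ((tripleBasis h).coord k)) =
      MvPolynomial.X k := by
    intro k
    refine MvPolynomial.funext fun s => ?_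
    have h1 := MvPolynomial.comp_aeval_apply x (MvPolynomial.aeval (R := ℂ) s)
      (linearPoly ((tripleBasis h).coord k))
    simp only [MvPolynomial.aeval_eq_eval, hx] at h1
    refine h1.trans ?_
    have h2 := coord_tripleBasis h (s 0) (s 1) (s 2)
    change MvPolynomial.eval _ _ = _
    rw [eval_linearPoly, MvPolynomial.eval_X]
    fin_cases k
    exacts [h2.1, h2.2.1, h2.2.2]
  let y : Fin 3 → MvPolynomial (Fin 3) ℂ := fun k => linearPoly ((tripleBasis h).coord k)
  have hy : ∀ P, MvPolynomial.aeval y (MvPolynomial.aeval x P) = P := by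
    intro P
    have h1 : (MvPolynomial.aeval y).comp (MvPolynomial.aeval (R := ℂ) x) = AlgHom.id ℂ _ := by
      refine MvPolynomial.algHom_ext fun i => MvPolynomial.funext fun s => ?_
      obtain ⟨a, b, c, habc⟩ := exists_eq_of_linearIndependent h s
      have h2 := coord_tripleBasis h a b c
      rw [← habc] at h2
      simp only [AlgHom.comp_apply, MvPolynomial.aeval_X, AlgHom.id_apply, x, map_add, map_mul,
        MvPolynomial.aeval_C, MvPolynomial.algebraMap_eq, MvPolynomial.eval_C, y,
        eval_linearPoly, h2, MvPolynomial.eval_X]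
      rw [habc]
      simp
      ring
    exact DFunLike.congr_fun h1 P
  let A : (Fin 3 → ℂ) → MvPolynomial (Fin 2) ℂ :=
    F.normalForm p q m (MvPolynomial.X 0) (MvPolynomial.X 1)
  have hA : ∀ w, MvPolynomial.aeval ![MvPolynomial.X 0, MvPolynomial.X 1] (A w) =
      F.normalForm p q m (MvPolynomial.X 0 : MvPolynomial (Fin 3) ℂ) (MvPolynomial.X 1) w := by
    intro w
    simp only [A]
    rw [map_normalForm]
    simp
  have hAe : ∀ w s, MvPolynomial.eval s (A w) = F.derivOver (s 0 • p + s 1 • q) m w := by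
    intro w s
    simp only [A]
    rw [eval_normalForm, MvPolynomial.eval_X, MvPolynomial.eval_X]
  have hunit : IsUnit (MvPolynomial.aeval x g) := by
    have hdvd : ∀ w : Fin 3 → MvPolynomial (Fin 3) ℂ, MvPolynomial.aeval x g ∣
        ∑ i, MvPolynomial.aeval x (F.coneCoeff h i) * w i := fun w =>
      Finset.dvd_sum fun i _ => (map_dvd _ (hg i)).mul_right _
    have hw : ∀ (w : Fin 3 → ℂ) k, MvPolynomial.aeval (constVec (MvPolynomial (Fin 3) ℂ) w)
        (linearPoly ((tripleBasis h).coord k)) = MvPolynomial.C ((tripleBasis h).coord k w) := by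
      intro w k
      rw [← eval_linearPoly, aeval_linearPoly]
      simp [linearPoly, constVec]
    have hp0 := coord_tripleBasis h 1 0 0
    have hq0 := coord_tripleBasis h 0 1 0
    have hm0 := coord_tripleBasis h 0 0 1
    simp only [one_smul, zero_smul, add_zero, zero_add] at hp0 hq0 hm0
    refine MvPolynomial.isUnit_of_dvd_cone (A := A p) (B := A q) ?_ ?_ ?_ ?_ ?_
    · intro s h1 h2
      rw [hAe] at h1 h2
      have := hAB _ _ h1 h2
      ext i
      fin_cases i
      exacts [this.1, this.2]
    · obtain ⟨a, b, hab⟩ := hC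
      refine ⟨![a, b], ?_⟩
      simpa only [hAe, derivOver_add, derivOver_smul, Matrix.cons_val_zero, Matrix.cons_val_one]
        using hab
    · have := hdvd (constVec _ p)
      simp only [sum_coneCoeff_mul, hxL, hw, hp0] at this
      simpa only [map_one, map_zero, mul_one, mul_zero, add_zero, zero_add, sub_zero, zero_sub,
        hA] using this
    · have := hdvd (constVec _ q)
      simp only [sum_coneCoeff_mul, hxL, hw, hq0] at this
      simpa only [map_one, map_zero, mul_one, mul_zero, add_zero, zero_add, sub_zero, zero_sub,
        hA] using this
    · have := hdvd (constVec _ m)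
      simp only [sum_coneCoeff_mul, hxL, hw, hm0] at this
      rw [← dvd_neg]
      simpa only [map_one, map_zero, mul_one, mul_zero, add_zero, zero_add, sub_zero, zero_sub,
        hA] using this
  have := hunit.map (MvPolynomial.aeval y)
  rwa [hy] at this

/-- The homogeneous foliation which has the same normal derivative as `F` along the line spanned by
`p` and `q`. -/
def cone (h : LinearIndependent ℂ ![p, q, m])
    (hAB : ∀ x y : ℂ, F.derivOver (x • p + y • q) m p = 0 →
      F.derivOver (x • p + y • q) m q = 0 → x = 0 ∧ y = 0)
    (hC : ∃ x y : ℂ, F.derivOver (x • p + y • q) m (x • p + y • q) ≠ 0) : Foliation d where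
  coeff := F.coneCoeff h
  homogeneous := F.isHomogeneous_coneCoeff h
  euler := F.euler_coneCoeff h
  no_common_factor _ := F.isUnit_of_dvd_coneCoeff h hAB hC

theorem form_cone (h : LinearIndependent ℂ ![p, q, m]) (hAB) (hC) (a b c a' b' c' : ℂ) :
    (F.cone h hAB hC).form (a • p + b • q + c • m) (a' • p + b' • q + c' • m) =
      c * F.derivOver (a • p + b • q) m (a' • p + b' • q) -
        F.derivOver (a • p + b • q) m (a • p + b • q) * c' := by
  rw [form_eq_formOver]
  refine (F.sum_coneCoeff_mul h _ _).trans ?_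
  obtain ⟨h0, h1, h2⟩ := coord_tripleBasis h a b c
  obtain ⟨h0', h1', h2'⟩ := coord_tripleBasis h a' b' c'
  simp only [MvPolynomial.aeval_eq_eval, eval_linearPoly, h0, h1, h2, h0', h1',
    h2', derivOver_add, derivOver_smul, normalForm, constVec_self]
  ring

theorem isHomogeneousAt_cone {l : PlaneLine} (h : LinearIndependent ℂ ![p, q, m]) (hp : p ∈ l.1)
    (hq : q ∈ l.1) (hAB) (hC) : (F.cone h hAB hC).IsHomogeneousAt l := by
  refine ⟨![p, q, m], F.normalForm p q m (MvPolynomial.X 0) (MvPolynomial.X 1) p,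
    F.normalForm p q m (MvPolynomial.X 0) (MvPolynomial.X 1) q, h, hp, hq,
    F.isHomogeneous_normalForm _ _ _ (MvPolynomial.isHomogeneous_X _ _)
      (MvPolynomial.isHomogeneous_X _ _) _,
    F.isHomogeneous_normalForm _ _ _ (MvPolynomial.isHomogeneous_X _ _)
      (MvPolynomial.isHomogeneous_X _ _) _, MvPolynomial.isRelPrime_of_forall_eval ?_, ?_⟩
  · intro s h1 h2
    rw [eval_normalForm, MvPolynomial.eval_X, MvPolynomial.eval_X] at h1 h2
    have := hAB _ _ h1 h2
    ext i
    fin_cases i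
    exacts [this.1, this.2]
  · intro x y x' y'
    have := F.form_cone h hAB hC x y 1 x' y' 0
    rw [one_smul, zero_smul, add_zero] at this
    refine this.trans ?_
    simp only [eval_normalForm, MvPolynomial.eval_X, derivOver_add, derivOver_smul]
    simp
    ring

end Foliation

/-! ### Inflection points of the leaves of the homogeneous foliation -/

theorem deriv_deriv_mul {f g : ℂ → ℂ} (hf : AnalyticAt ℂ f 0) (hg : AnalyticAt ℂ g 0) :
    deriv (deriv (fun t => f t * g t)) 0 =
      deriv (deriv f) 0 * g 0 + 2 * (deriv f 0 * deriv g 0) + f 0 * deriv (deriv g) 0 := by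
  have h1 : deriv (fun t => f t * g t) =ᶠ[𝓝 0] fun t => deriv f t * g t + f t * deriv g t := by
    filter_upwards [hf.eventually_analyticAt, hg.eventually_analyticAt] with t h1 h2
    exact (h1.differentiableAt.hasDerivAt.mul h2.differentiableAt.hasDerivAt).deriv
  rw [h1.deriv_eq]
  have h2 := (hf.deriv.differentiableAt.hasDerivAt.mul hg.differentiableAt.hasDerivAt).add
    (hf.differentiableAt.hasDerivAt.mul hg.deriv.differentiableAt.hasDerivAt)
  refine (h2.congr_of_eventuallyEq (.of_forall fun t => ?_)).deriv.trans ?_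
  · simp
  · ring

/-- At an inflection point of a solution of `b(u) v du = (a(u) + u b(u)) dv`, the Wronskian of `a`
and `b` vanishes or `a` does. -/
theorem wronskian_eq_zero_of_inflection {a b : Polynomial ℂ} {u v : ℂ → ℂ} (hu : AnalyticAt ℂ u 0)
    (hv : AnalyticAt ℂ v 0) (hu0 : u 0 = 0) (hv0 : v 0 ≠ 0)
    (h : ∀ᶠ t in 𝓝 (0 : ℂ), v t * (deriv u t * b.eval (u t)) -
      (a.eval (u t) + u t * b.eval (u t)) * deriv v t = 0)
    (h' : deriv u 0 ≠ 0 ∨ deriv v 0 ≠ 0) {k : ℂ} (hk : deriv (deriv u) 0 = k * deriv u 0)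
    (hk' : deriv (deriv v) 0 = k * deriv v 0) (ha : a.eval 0 ≠ 0) :
    (a * b.derivative - a.derivative * b).eval 0 = 0 := by
  have hu1 := hu.differentiableAt.hasDerivAt
  have hv1 := hv.differentiableAt.hasDerivAt
  have hu2 := hu.deriv.differentiableAt.hasDerivAt
  have hv2 := hv.deriv.differentiableAt.hasDerivAt
  have hpoly : ∀ c : Polynomial ℂ,
      HasDerivAt (fun t => c.eval (u t)) (c.derivative.eval 0 * deriv u 0) 0 := by
    intro c
    have := (c.hasDerivAt (u 0)).comp 0 hu1
    rwa [hu0] at this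
  -- Differentiate the leaf equation at 0. Since (u'', v'') = k(u', v'), the second-order terms are
  -- k times the equation itself and drop out, leaving u'(b'vu' - a'v') = 0.
  have h1 := (hv1.mul (hu2.mul (hpoly b))).sub (((hpoly a).add (hu1.mul (hpoly b))).mul hv2)
  have h2 : (fun _ : ℂ => (0 : ℂ)) =ᶠ[𝓝 0] (v * (deriv u * fun t => b.eval (u t)) -
      ((fun t => a.eval (u t)) + u * fun t => b.eval (u t)) * deriv v) := by
    filter_upwards [h] with t ht
    exact ht.symm
  have h3 := (h1.congr_of_eventuallyEq h2).unique (hasDerivAt_const 0 0)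
  have h0 := h.self_of_nhds
  simp only [Pi.mul_apply, Pi.add_apply, hu0, hk, hk'] at h3 h0
  simp only [Polynomial.eval_sub, Polynomial.eval_mul]
  rw [zero_mul, add_zero] at h0
  have h4 : deriv u 0 * (b.derivative.eval 0 * (v 0 * deriv u 0) - a.derivative.eval 0 * deriv v 0)
      = 0 := by linear_combination h3 - k * h0
  by_cases hu' : deriv u 0 = 0
  · rw [hu'] at h0
    simp [ha] at h0
    exact absurd h0 (h'.resolve_left (by simp [hu']))
  · have h5 := (mul_eq_zero.1 h4).resolve_left hu'
    have h6 : (v 0 * deriv u 0) * (a.eval 0 * b.derivative.eval 0 -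
        a.derivative.eval 0 * b.eval 0) = 0 := by
      linear_combination a.eval 0 * h5 - a.derivative.eval 0 * h0
    exact (mul_eq_zero.1 h6).resolve_left (mul_ne_zero hv0 hu')

theorem analyticAt_clm_comp {γ : ℂ → Fin 3 → ℂ} (hγ : AnalyticAt ℂ γ 0)
    (φ : (Fin 3 → ℂ) →L[ℂ] ℂ) :
    AnalyticAt ℂ (fun t => φ (γ t)) 0 ∧
    deriv (fun t => φ (γ t)) =ᶠ[𝓝 0] (fun t => φ (deriv γ t)) := by
  refine ⟨(φ.analyticAt _).comp hγ, ?_⟩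
  filter_upwards [hγ.eventually_analyticAt] with t ht
  exact (φ.hasFDerivAt.comp_hasDerivAt t ht.differentiableAt.hasDerivAt).deriv

namespace Foliation

variable {d : ℕ} {F : Foliation d}

/-- The foliation equation in affine coordinates. -/
theorem form_affine_eq_zero (H : Foliation d) {x : ℂ} (hx : x ≠ 0) {g g' : Fin 3 → ℂ} {x' : ℂ}
    (h : H.form (x • g) (x' • g + x • g') = 0) : H.form g g' = 0 := by
  rw [form_eq_formOver] at *
  rw [formOver_smul_point, formOver_add, formOver_smul, formOver_smul, formOver_self] at h
  simpa [hx] using h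

theorem exists_eq_of_not_linearIndependent {v₀ v₁ v₂ : Fin 3 → ℂ}
    (h : LinearIndependent ℂ ![v₀, v₁]) (h' : ¬ LinearIndependent ℂ ![v₀, v₁, v₂]) :
    ∃ a b : ℂ, v₂ = a • v₀ + b • v₁ := by
  rw [linearIndependent_triple_iff] at h'
  push Not at h'
  obtain ⟨a, b, c, habc, hne⟩ := h'
  have hc : c ≠ 0 := by
    rintro rfl
    have := LinearIndependent.pair_iff.1 h a b (by simpa using habc)
    exact hne this.1 this.2 rfl
  refine ⟨-(a / c), -(b / c), ?_⟩
  have h1 : c • v₂ = (-a) • v₀ + (-b) • v₁ := by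
    rw [← sub_eq_zero, ← habc]; module
  have h2 := congrArg (fun x => c⁻¹ • x) h1
  simp only [smul_smul, inv_mul_cancel₀ hc, one_smul, smul_add] at h2
  rw [h2]
  congr 2 <;> ring

theorem exists_linearIndependent_mem {l : PlaneLine} {p : Fin 3 → ℂ} (hp0 : p ≠ 0) :
    ∃ q ∈ l.1, LinearIndependent ℂ ![p, q] := by
  by_contra! hall
  have h1 : l.1 ≤ Submodule.span ℂ {p} := by
    intro w hw
    have h2 := hall w hw
    rw [LinearIndependent.pair_iff' hp0] at h2
    push Not at h2
    obtain ⟨a, ha⟩ := h2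
    exact Submodule.mem_span_singleton.2 ⟨a, ha⟩
  have h3 := Submodule.finrank_mono h1
  rw [l.2, finrank_span_singleton hp0] at h3
  omega

/-- Any nonzero vector of an invariant line belongs to a basis of the line whose second vector
represents a nonsingular point. -/
theorem exists_linearIndependent_form_ne_zero {l : PlaneLine} (hl : F.IsInvariant l)
    {p m : Fin 3 → ℂ} (hp : p ∈ l.1) (hp0 : p ≠ 0) (hm : m ∉ l.1) :
    ∃ q ∈ l.1, LinearIndependent ℂ ![p, q, m] ∧ F.form q m ≠ 0 := by
  obtain ⟨q, hq, hpq⟩ := exists_linearIndependent_mem (l := l) hp0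
  have hind := PlaneLine.linearIndependent_triple hpq hp hq hm
  obtain ⟨t, ht⟩ := exists_form_ne_zero hl hind hp hq
  refine ⟨q + t • p, add_mem hq (l.1.smul_mem _ hp), ?_, ht⟩
  rw [linearIndependent_triple_iff] at hind ⊢
  intro a b c habc
  obtain ⟨h1, rfl, h3⟩ := hind (a + b * t) b c (by rw [← habc]; module)
  exact ⟨by simpa using h1, rfl, h3⟩

/-- A foliation which has the shape of a cone along an invariant line of a reduced convex foliation
is convex. -/
theorem isConvex_of_form_eq (hd : 2 ≤ d) (hF : F.IsReducedConvex) {l : PlaneLine}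
    (hl : F.IsInvariant l) {m : Fin 3 → ℂ} (hm : m ∉ l.1) (H : Foliation d)
    (hH : ∀ v ∈ l.1, ∀ v' ∈ l.1, ∀ c c' : ℂ, H.form (v + c • m) (v' + c' • m) =
      c * F.derivOver v m v' - F.derivOver v m v * c') : H.IsConvex := by
  rintro γ ⟨hγ, hγind, ⟨w, hw⟩, hγF⟩ hinfl
  -- The vertex [m] is singular for `H`, so the nonsingular point [γ 0] projects from it to a
  -- well-defined point [p] of `l`.
  have hzero : ∀ c : ℂ, ∀ w, H.form (c • m) w = 0 := by
    intro c w
    obtain ⟨e, he⟩ := l.exists_add_smul_mem hm w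
    have h1 := hH 0 l.1.zero_mem _ he c (-e)
    have h2 : ∀ y : Fin 3 → ℂ, F.derivOver (0 : Fin 3 → ℂ) m y = 0 := by
      intro y
      have := F.derivOver_smul_point (0 : Fin 3 → ℂ) m y (0 : ℂ)
      rwa [smul_zero, zero_pow (by omega), zero_mul] at this
    rw [h2, h2, zero_add] at h1
    simpa using h1
  obtain ⟨e, he⟩ := l.exists_add_smul_mem hm (γ 0)
  by_cases he0 : e = 0
  · subst he0
    refine ⟨l, fun x hx v hv => ?_, by simpa using he⟩
    simpa using hH x hx v hv 0 0
  set p : Fin 3 → ℂ := γ 0 + e • m with hp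
  have hγ0 : γ 0 = p + (-e) • m := by rw [hp]; module
  have hp0 : p ≠ 0 := by
    intro h0
    rw [hγ0, h0, zero_add] at hw
    exact hw (hzero _ _)
  obtain ⟨q, hq, hind, hns⟩ := exists_linearIndependent_form_ne_zero hl he hp0 hm
  obtain ⟨M, hM, -⟩ := exists_isReducedConvexPair hd hF hl hind he hq hns
  -- If A vanishes at the parameter of `p`, the radial line joining `p` to `m` is invariant by `H`
  -- and contains the point.
  by_cases ha : (F.normalDeriv p q m p).eval 0 = 0
  · rw [eval_normalDeriv, zero_smul, add_zero] at ha
    have hind' : LinearIndependent ℂ ![p, m] := by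
      rw [LinearIndependent.pair_iff]
      intro a b hab
      have := linearIndependent_triple_iff.1 hind a 0 b (by simpa using hab)
      exact ⟨this.1, this.2.2⟩
    refine ⟨PlaneLine.through p m hind', ?_, PlaneLine.mem_through.2 ⟨1, -e, by rw [hγ0]; simp⟩⟩
    intro x hx v hv
    obtain ⟨a, b, rfl⟩ := PlaneLine.mem_through.1 hx
    obtain ⟨a', b', rfl⟩ := PlaneLine.mem_through.1 hv
    rw [hH _ (l.1.smul_mem _ he) _ (l.1.smul_mem _ he), derivOver_smul_point, derivOver_smul_point,
      derivOver_smul, derivOver_smul, ha]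
    ring
  exfalso
  let φ : Fin 3 → ((Fin 3 → ℂ) →L[ℂ] ℂ) := fun k =>
    LinearMap.toContinuousLinearMap ((tripleBasis hind).coord k)
  have hφ : ∀ w, w = φ 0 w • p + φ 1 w • q + φ 2 w • m := by
    intro w
    obtain ⟨a, b, c, rfl⟩ := exists_eq_of_linearIndependent hind w
    obtain ⟨h0, h1, h2⟩ := coord_tripleBasis hind a b c
    simp only [φ, LinearMap.coe_toContinuousLinearMap', h0, h1, h2]
  have hφγ := coord_tripleBasis hind 1 0 (-e)
  rw [one_smul, zero_smul, add_zero, ← hγ0] at hφγ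
  have hx0 : φ 0 (γ 0) = 1 := hφγ.1
  have hy0 : φ 1 (γ 0) = 0 := hφγ.2.1
  have hz0 : φ 2 (γ 0) = -e := hφγ.2.2
  have han := fun k => (analyticAt_clm_comp hγ (φ k)).1
  have hd1 := fun k => (analyticAt_clm_comp hγ (φ k)).2
  have hd2 : ∀ k, deriv (deriv fun t => φ k (γ t)) 0 = φ k (deriv (deriv γ) 0) := fun k => by
    rw [(hd1 k).deriv_eq, (analyticAt_clm_comp hγ.deriv (φ k)).2.self_of_nhds]
  have hxne : φ 0 (γ 0) ≠ 0 := by rw [hx0]; exact one_ne_zero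
  let u : ℂ → ℂ := fun t => φ 1 (γ t) / φ 0 (γ t)
  let v : ℂ → ℂ := fun t => φ 2 (γ t) / φ 0 (γ t)
  have hu : AnalyticAt ℂ u 0 := (han 1).div (han 0) hxne
  have hv : AnalyticAt ℂ v 0 := (han 2).div (han 0) hxne
  have hu0 : u 0 = 0 := by simp [u, hy0]
  have hv0 : v 0 = -e := by simp [v, hz0, hx0]
  have hev : ∀ᶠ t in 𝓝 (0 : ℂ), φ 0 (γ t) ≠ 0 := (han 0).continuousAt.eventually_ne hxne
  have hyu : (fun t => φ 1 (γ t)) =ᶠ[𝓝 0] fun t => φ 0 (γ t) * u t := by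
    filter_upwards [hev] with t ht
    simp only [u]; field_simp
  have hzv : (fun t => φ 2 (γ t)) =ᶠ[𝓝 0] fun t => φ 0 (γ t) * v t := by
    filter_upwards [hev] with t ht
    simp only [v]; field_simp
  have hder : ∀ {f g : ℂ → ℂ}, f =ᶠ[𝓝 0] (fun t => φ 0 (γ t) * g t) → AnalyticAt ℂ g 0 →
      ∀ᶠ t in 𝓝 (0 : ℂ), deriv f t = φ 0 (deriv γ t) * g t + φ 0 (γ t) * deriv g t := by
    intro f g hfg hg
    filter_upwards [hfg.deriv, (han 0).eventually_analyticAt, hg.eventually_analyticAt, hd1 0]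
      with t h1 h2 h3 h4
    rw [h1, ← h4]
    exact (h2.differentiableAt.hasDerivAt.mul h3.differentiableAt.hasDerivAt).deriv
  have hyd := hder hyu hu
  have hzd := hder hzv hv
  have heq : ∀ᶠ t in 𝓝 (0 : ℂ),
      v t * (deriv u t * (F.normalDeriv p q m q).eval (u t)) -
      ((F.normalDeriv p q m p).eval (u t) + u t * (F.normalDeriv p q m q).eval (u t)) *
        deriv v t = 0 := by
    filter_upwards [hγF, hev, hyu, hzv, hyd, hzd, hd1 1, hd1 2] with t h1 h2 h3 h4 h5 h6 h7 h8
    have hg : γ t = φ 0 (γ t) • (p + u t • q + v t • m) := by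
      conv_lhs => rw [hφ (γ t), h3, h4]
      module
    have hg' : deriv γ t = φ 0 (deriv γ t) • (p + u t • q + v t • m) +
        φ 0 (γ t) • (deriv u t • q + deriv v t • m) := by
      conv_lhs => rw [hφ (deriv γ t), ← h7, ← h8, h5, h6]
      module
    rw [hg'] at h1
    conv at h1 => lhs; arg 2; rw [hg]
    have h9 := form_affine_eq_zero H h2 h1
    rw [hH _ (add_mem he (l.1.smul_mem _ hq)) _ (l.1.smul_mem _ hq)] at h9
    rw [derivOver_add, derivOver_smul, derivOver_smul] at h9
    simp only [eval_normalDeriv]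
    exact h9
  have hd10 : ∀ k, deriv (fun t => φ k (γ t)) 0 = φ k (deriv γ 0) := fun k =>
    (hd1 k).self_of_nhds
  have hy1 := hyd.self_of_nhds
  have hz1 := hzd.self_of_nhds
  rw [hd10 1, hx0, hu0] at hy1
  rw [hd10 2, hx0, hv0] at hz1
  have hne : deriv u 0 ≠ 0 ∨ deriv v 0 ≠ 0 := by
    by_contra! h0
    rw [h0.1] at hy1
    rw [h0.2] at hz1
    obtain ⟨c, h1⟩ : ∃ c : ℂ, deriv γ 0 = c • γ 0 := by
      refine ⟨φ 0 (deriv γ 0), ?_⟩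
      conv_lhs => rw [hφ (deriv γ 0), hy1, hz1]
      rw [hγ0]
      module
    have h2 := LinearIndependent.pair_iff.1 hγind c (-1) (by rw [h1]; simp)
    simpa using h2.2
  obtain ⟨α, β, hαβ⟩ := exists_eq_of_not_linearIndependent hγind hinfl
  rw [iteratedDeriv_succ, iteratedDeriv_one] at hαβ
  have hk : ∀ k, φ k (deriv (deriv γ) 0) = α * φ k (γ 0) + β * φ k (deriv γ 0) := by
    intro k; rw [hαβ]; simp
  have hy2 := hyu.deriv.deriv_eq
  have hz2 := hzv.deriv.deriv_eq
  rw [deriv_deriv_mul (han 0) hu, hd2, hd2, hd10 0, hk, hk, hx0, hy0, hu0, hy1] at hy2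
  rw [deriv_deriv_mul (han 0) hv, hd2, hd2, hd10 0, hk, hk, hx0, hz0, hv0, hz1] at hz2
  -- Write γ = x(p + uq + vm) with x(0) = 1, and γ'' = αγ + βγ' at 0. Comparing second derivatives
  -- gives (u'', v'') = (β - 2x')(u', v').
  have hW := wronskian_eq_zero_of_inflection hu hv hu0 (by rw [hv0]; exact neg_ne_zero.2 he0) heq
    hne (k := β - 2 * φ 0 (deriv γ 0)) (by linear_combination -hy2) (by linear_combination -hz2) ha
  have := hM.eval_eq_zero_of_wronskian hW
  rw [Polynomial.eval_add, Polynomial.eval_mul, Polynomial.eval_X, zero_mul, add_zero] at this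
  exact ha this

end Foliation

/-! ### Camacho-Sad indices -/

/-- Write c = Xh with h(0) = c'(0) ≠ 0; this is then Cauchy's integral formula for -b/h on small
circles. -/
theorem hasResidue_iff_of_simple_zero {b c : Polynomial ℂ} (hc : c.eval 0 = 0)
    (hc' : c.derivative.eval 0 ≠ 0) (r : ℂ) :
    HasResidue (fun z => -(b.eval z / c.eval z)) 0 r ↔ r = -(b.eval 0 / c.derivative.eval 0) := by
  obtain ⟨h, rfl⟩ : Polynomial.X ∣ c := by
    rwa [Polynomial.X_dvd_iff, Polynomial.coeff_zero_eq_eval_zero]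
  have hh : (Polynomial.X * h).derivative.eval 0 = h.eval 0 := by simp
  rw [hh] at hc' ⊢
  have hint : ∀ᶠ R in 𝓝[>] (0 : ℝ),
      (∮ z in C(0, R), -(b.eval z / (Polynomial.X * h).eval z)) =
        2 * Real.pi * Complex.I * -(b.eval 0 / h.eval 0) := by
    have h1 : ∀ᶠ z in 𝓝 (0 : ℂ), h.eval z ≠ 0 := h.continuous.continuousAt.eventually_ne hc'
    obtain ⟨ε, hε, hball⟩ := Metric.eventually_nhds_iff_ball.1 h1
    filter_upwards [Ioo_mem_nhdsGT hε] with R hR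
    have hd : DiffContOnCl ℂ (fun z => -(b.eval z / h.eval z)) (Metric.ball 0 R) := by
      refine DifferentiableOn.diffContOnCl fun z hz => ?_
      have hz' : z ∈ Metric.ball (0 : ℂ) ε := by
        have := Metric.closure_ball_subset_closedBall hz
        rw [Metric.mem_closedBall] at this
        exact this.trans_lt hR.2
      exact ((b.differentiable z).div (h.differentiable z) (hball z hz')).neg.differentiableWithinAt
    have h2 := hd.circleIntegral_sub_inv_smul (Metric.mem_ball_self hR.1)
    rw [smul_eq_mul] at h2
    rw [← h2]
    congr 1
    ext z
    simp only [Polynomial.eval_mul, Polynomial.eval_X, sub_zero, smul_eq_mul, div_eq_mul_inv,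
      mul_inv]
    ring
  constructor
  · intro hr
    obtain ⟨R, h1, h2⟩ := (hr.and hint).exists
    exact mul_left_cancel₀ Complex.two_pi_I_ne_zero (h1.symm.trans h2)
  · rintro rfl
    exact hint

namespace Foliation

variable {d : ℕ} {F : Foliation d} {l : PlaneLine} {p q m : Fin 3 → ℂ}

theorem derivOver_eq_zero_of_mem (hl : F.IsInvariant l) (hp : p ∈ l.1) {v w : Fin 3 → ℂ}
    (hv : v ∈ l.1) (hw : w ∈ l.1) : F.derivOver p v w = 0 := by
  refine (F.hasDerivAt_form p v w).unique ?_
  have : (fun t : ℂ => F.form (p + t • v) w) = fun _ => 0 :=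
    funext fun t => hl _ (add_mem hp (l.1.smul_mem _ hv)) _ hw
  rw [this]
  exact hasDerivAt_const 0 0

theorem derivOver_self_eq_zero {w : Fin 3 → ℂ} (h : F.form p w = 0) : F.derivOver p p w = 0 := by
  refine (F.hasDerivAt_form p p w).unique ?_
  have : (fun t : ℂ => F.form (p + t • p) w) = fun _ => 0 := by
    funext t
    rw [show p + t • p = (1 + t) • p by module, form_eq_formOver, formOver_smul_point,
      ← form_eq_formOver, h, mul_zero]
  rw [this]
  exact hasDerivAt_const 0 0

theorem form_eq_zero_of_form_eq_zero (hl : F.IsInvariant l) (hp : p ∈ l.1) (hm : m ∉ l.1)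
    (h : F.form p m = 0) (w : Fin 3 → ℂ) : F.form p w = 0 := by
  obtain ⟨c, hc⟩ := l.exists_add_smul_mem hm w
  have h1 := hl p hp _ hc
  rw [form_eq_formOver] at *
  rwa [formOver_add, formOver_smul, h, mul_zero, add_zero] at h1

/-- All singular points on an invariant line of a reduced convex foliation are non-degenerate, and
another invariant line passes through them. -/
theorem derivOver_ne_zero (hd : 2 ≤ d) (hF : F.IsReducedConvex) (hl : F.IsInvariant l)
    (hind : LinearIndependent ℂ ![p, q, m]) (hp : p ∈ l.1) (hq : q ∈ l.1) (h0 : F.form p m = 0) :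
    F.derivOver p m q ≠ 0 ∧ F.derivOver p q m ≠ 0 ∧
      ∃ l', l' ≠ l ∧ F.IsInvariant l' ∧ p ∈ l'.1 := by
  have hm := PlaneLine.notMem_of_triple hind hp hq
  -- The given `q` may be singular, so the count is made with another vector q'. Passing from q' to
  -- q only multiplies both derivatives by a nonzero scalar b, as those in the direction of `p`
  -- vanish.
  obtain ⟨q', hq', hind', hns⟩ := exists_linearIndependent_form_ne_zero hl hp
    (hind.ne_zero 0) hm
  obtain ⟨M, hM, hM'⟩ := exists_isReducedConvexPair hd hF hl hind' hp hq' hns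
  have hC : (F.normalDeriv p q' m p + Polynomial.X * F.normalDeriv p q' m q').eval 0 = 0 := by
    rw [eval_normalDeriv_add, zero_smul, add_zero, h0, neg_zero]
  have hB := hM.eval_right_ne_zero hC
  rw [eval_normalDeriv, zero_smul, add_zero] at hB
  have hC' : F.derivOver p q' m ≠ 0 := by
    intro h1
    have h2 := F.hasDerivAt_form p q' m
    have h3 : (fun u : ℂ => F.form (p + u • q') m) = fun u =>
        -(F.normalDeriv p q' m p + Polynomial.X * F.normalDeriv p q' m q').eval u := by
      funext u; rw [eval_normalDeriv_add, neg_neg]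
    rw [h3, h1] at h2
    have h4 := h2.unique (Polynomial.hasDerivAt _ 0).neg
    exact hM.eval_derivative_ne_zero hC (neg_eq_zero.1 h4.symm)
  obtain ⟨a, b, hab⟩ := PlaneLine.exists_eq_of_mem hind' hp hq' hq
  have hb : b ≠ 0 := by
    rintro rfl
    have := linearIndependent_triple_iff.1 hind a (-1) 0 (by rw [hab]; module)
    simpa using this.2.1
  refine ⟨?_, ?_, ?_⟩
  · have h1 : F.derivOver p m p = 0 := by
      have := F.derivOver_self_add_formOver p m
      rwa [← form_eq_formOver, h0, add_zero] at this
    rw [hab, derivOver_add, derivOver_smul, derivOver_smul, h1, mul_zero, zero_add]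
    exact mul_ne_zero hb hB
  · rw [hab, derivOver_add_direction, derivOver_smul_direction, derivOver_smul_direction,
      derivOver_self_eq_zero h0, mul_zero, zero_add]
    exact mul_ne_zero hb hC'
  · obtain ⟨l', h1, h2, h3⟩ := hM' 0 (hM.mem_of_eval_eq_zero hC)
    exact ⟨l', h1, h2, by simpa using h3⟩

theorem deriv_duCoeff (F : Foliation d) (p q m : Fin 3 → ℂ) (u : ℂ) :
    deriv (fun v => F.duCoeff p q m u v) 0 = F.derivOver (p + u • q) m q :=
  (F.hasDerivAt_form (p + u • q) m q).deriv

/-- The residue defining the Camacho-Sad index at a simple zero. -/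
theorem hasResidue_camachoSad_iff (h0 : F.form p m = 0) (h1 : F.derivOver p q m ≠ 0) (c : ℂ) :
    HasResidue (fun u => -(deriv (fun v => F.duCoeff p q m u v) 0 / F.dvCoeff p q m u 0)) 0 c ↔
      c = -(F.derivOver p m q / F.derivOver p q m) := by
  set P : Polynomial ℂ := F.formOver (constVec (Polynomial ℂ) p + (Polynomial.X : Polynomial ℂ) •
    constVec (Polynomial ℂ) q) (constVec _ m) with hP
  have hPe : ∀ u, P.eval u = F.form (p + u • q) m := by
    intro u
    rw [hP, eval_formOver, form_eq_formOver]
    congr 1 <;> ext i <;> simp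
  have hP' : P.derivative.eval 0 = F.derivOver p q m := by
    refine HasDerivAt.unique ?_ (F.hasDerivAt_form p q m)
    rw [← funext hPe]
    exact P.hasDerivAt 0
  have hfun : (fun u => -(deriv (fun v => F.duCoeff p q m u v) 0 / F.dvCoeff p q m u 0)) =
      fun u => -((F.normalDeriv p q m q).eval u / P.eval u) := by
    funext u
    rw [deriv_duCoeff, eval_normalDeriv, hPe, dvCoeff, zero_smul, add_zero]
  rw [hfun, hasResidue_iff_of_simple_zero (by rw [hPe, zero_smul, add_zero, h0])
    (by rwa [hP']), hP', eval_normalDeriv, zero_smul, add_zero]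

theorem isNondegenerateSingular_of_ne_zero {s : PlanePoint} (hl : F.IsInvariant l)
    (hs : F.IsSingular s) (hf : IsFrameAt s p q m) (hp : p ∈ l.1) (hq : q ∈ l.1)
    (h1 : F.derivOver p m q ≠ 0) (h2 : F.derivOver p q m ≠ 0) : F.IsNondegenerateSingular s := by
  refine ⟨hs, p, q, m, hf, ?_⟩
  have e1 : deriv (fun u => F.duCoeff p q m u 0) 0 = 0 := by
    have h := (F.hasDerivAt_form p q q).deriv
    rw [derivOver_eq_zero_of_mem hl hp hq hq] at h
    simpa [duCoeff] using h
  have e2 : deriv (fun v => F.duCoeff p q m 0 v) 0 = F.derivOver p m q := by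
    rw [deriv_duCoeff, zero_smul, add_zero]
  have e3 : deriv (fun u => F.dvCoeff p q m u 0) 0 = F.derivOver p q m := by
    rw [← (F.hasDerivAt_form p q m).deriv]
    simp [dvCoeff]
  rw [e1, e2, e3, zero_mul, zero_sub]
  exact neg_ne_zero.2 (mul_ne_zero h1 h2)

theorem form_eq_zero_of_isSingular {s : PlanePoint} (hs : F.IsSingular s)
    (hps : Submodule.span ℂ {p} = s.submodule) (w : Fin 3 → ℂ) : F.form p w = 0 := by
  have h1 : p ∈ s.submodule := by rw [← hps]; exact Submodule.mem_span_singleton_self p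
  rw [Projectivization.submodule_eq] at h1
  obtain ⟨a, rfl⟩ := Submodule.mem_span_singleton.1 h1
  rw [form_eq_formOver, formOver_smul_point, ← form_eq_formOver, hs w, mul_zero]

/-- The invariant lines through a singular point have inverse indices. -/
theorem inv_mem_camachoSadSet (hd : 2 ≤ d) (hF : F.IsReducedConvex) {c : ℂ}
    (hc : c ∈ F.camachoSadSet) : 1 / c ∈ F.camachoSadSet := by
  obtain ⟨hc0, hc1, l, s, hl, hsl, hs, p, q, m, ⟨hind, hps⟩, hp, hq, hres⟩ := hc
  have hsing := form_eq_zero_of_isSingular hs.1 hps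
  obtain ⟨h1, h2, l', hne, hl', hp'⟩ := derivOver_ne_zero hd hF hl hind hp hq (hsing m)
  rw [hasResidue_camachoSad_iff (hsing m) h2] at hres
  obtain ⟨n, hn', hn⟩ := PlaneLine.exists_mem_notMem hne.symm
  obtain ⟨a, b, e, habe⟩ := exists_eq_of_linearIndependent hind n
  have he : e ≠ 0 := by
    rintro rfl
    refine hn ?_
    rw [habe, zero_smul, add_zero]
    exact add_mem (l.1.smul_mem _ hp) (l.1.smul_mem _ hq)
  -- The frame for l' takes `n` along l' and `q` across it. Replacing `m` by `n` scales both mixed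
  -- derivatives by `e`, so the two indices are inverse to each other.
  have hind' : LinearIndependent ℂ ![p, n, q] := by
    rw [linearIndependent_triple_iff] at hind ⊢
    intro x y z hxyz
    obtain ⟨h3, h4, h5⟩ := hind (x + y * a) (y * b + z) (y * e) (by rw [← hxyz, habe]; module)
    obtain rfl := (mul_eq_zero.1 h5).resolve_right he
    simp only [zero_mul, add_zero, zero_add] at h3 h4
    exact ⟨h3, rfl, h4⟩
  have e1 : F.derivOver p n q = e * F.derivOver p m q := by
    rw [habe, derivOver_add_direction, derivOver_add_direction, derivOver_smul_direction,
      derivOver_smul_direction, derivOver_smul_direction, derivOver_self_eq_zero (hsing q),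
      derivOver_eq_zero_of_mem hl hp hq hq]
    ring
  have e2 : F.derivOver p q n = e * F.derivOver p q m := by
    rw [habe, derivOver_add, derivOver_add, derivOver_smul, derivOver_smul, derivOver_smul,
      derivOver_eq_zero_of_mem hl hp hq hp, derivOver_eq_zero_of_mem hl hp hq hq]
    ring
  refine ⟨one_div_ne_zero hc0, fun h => hc1 ?_, l', s, hl', ?_, hs, p, n, q, ⟨hind', hps⟩, hp', hn',
    ?_⟩
  · rw [div_eq_iff hc0, one_mul] at h
    exact h.symm
  · rw [PlanePoint.OnLine, ← hps, Submodule.span_singleton_le_iff_mem]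
    exact hp'
  · rw [hasResidue_camachoSad_iff (hsing q) (by rw [e1]; exact mul_ne_zero he h1), e1, e2, hres]
    field_simp

/-- The index along an invariant line of a reduced convex foliation is an index at infinity of a
homogeneous convex foliation. -/
theorem isHomogeneousConvexIndex_of_mem (hd : 2 ≤ d) (hF : F.IsReducedConvex) {c : ℂ}
    (hc : c ∈ F.camachoSadSet) : IsHomogeneousConvexIndex d c := by
  obtain ⟨-, -, l, s, hl, hsl, hs, p, q, m, ⟨hind, hps⟩, hp, hq, hres⟩ := hc
  have hm := PlaneLine.notMem_of_triple hind hp hq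
  have hpl : ∀ a b : ℂ, a • p + b • q ∈ l.1 := fun a b =>
    add_mem (l.1.smul_mem _ hp) (l.1.smul_mem _ hq)
  have hAB : ∀ x y : ℂ, F.derivOver (x • p + y • q) m p = 0 →
      F.derivOver (x • p + y • q) m q = 0 → x = 0 ∧ y = 0 := by
    intro x y h1 h2
    have h3 : ∀ w ∈ l.1, F.derivOver (x • p + y • q) m w = 0 := by
      intro w hw
      obtain ⟨a, b, rfl⟩ := PlaneLine.exists_eq_of_mem hind hp hq hw
      rw [derivOver_add, derivOver_smul, derivOver_smul, h1, h2]
      ring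
    by_cases h0 : x • p + y • q = 0
    · have := linearIndependent_triple_iff.1 hind x y 0 (by simpa using h0)
      exact ⟨this.1, this.2.1⟩
    · exfalso
      -- A common zero of A and B would be a singular point of `F` on `l` at which the normal
      -- derivative vanishes on all of `l`, contradicting non-degeneracy.
      obtain ⟨q', hq', hind', -⟩ := exists_linearIndependent_form_ne_zero hl (hpl x y) h0 hm
      have h4 := F.derivOver_self_add_formOver (x • p + y • q) m
      rw [h3 _ (hpl x y), zero_add] at h4
      exact (derivOver_ne_zero hd hF hl hind' (hpl x y) hq' h4).1 (h3 q' hq')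
  have hC : ∃ x y : ℂ, F.derivOver (x • p + y • q) m (x • p + y • q) ≠ 0 := by
    obtain ⟨q', hq', -, hns⟩ := exists_linearIndependent_form_ne_zero hl hp (hind.ne_zero 0) hm
    obtain ⟨x, y, rfl⟩ := PlaneLine.exists_eq_of_mem hind hp hq hq'
    refine ⟨x, y, fun h => hns ?_⟩
    have := F.derivOver_self_add_formOver (x • p + y • q) m
    rwa [h, zero_add] at this
  have hform : ∀ v ∈ l.1, ∀ v' ∈ l.1, ∀ c c' : ℂ,
      (F.cone hind hAB hC).form (v + c • m) (v' + c' • m) =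
        c * F.derivOver v m v' - F.derivOver v m v * c' := by
    intro v hv v' hv' c c'
    obtain ⟨a, b, rfl⟩ := PlaneLine.exists_eq_of_mem hind hp hq hv
    obtain ⟨a', b', rfl⟩ := PlaneLine.exists_eq_of_mem hind hp hq hv'
    exact F.form_cone hind hAB hC a b c a' b' c'
  have hformm : ∀ v ∈ l.1, (F.cone hind hAB hC).form v m = F.form v m := by
    intro v hv
    have h1 := hform v hv 0 l.1.zero_mem 0 1
    have h2 := F.derivOver_self_add_formOver v m
    rw [zero_smul, add_zero, one_smul, zero_add] at h1
    rw [h1, form_eq_formOver]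
    linear_combination -h2
  refine ⟨F.cone hind hAB hC, l, s, F.isHomogeneousAt_cone hind hp hq hAB hC,
    isConvex_of_form_eq hd hF hl hm _ hform, hsl, ?_, p, q, m, ⟨hind, hps⟩, hp, hq, ?_⟩
  · have hrep : s.rep ∈ l.1 := hsl (by
      rw [Projectivization.submodule_eq]; exact Submodule.mem_span_singleton_self _)
    have hinv : (F.cone hind hAB hC).IsInvariant l := by
      intro x hx v hv
      simpa using hform x hx v hv 0 0
    exact form_eq_zero_of_form_eq_zero hinv hrep hm ((hformm _ hrep).trans (hs.1 m))
  -- The residue involves only ∂α/∂v and β on v = 0, and the cone agrees with `F` in both.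
  · convert hres using 2 with u
    have hu : p + u • q ∈ l.1 := by simpa using hpl 1 u
    rw [deriv_duCoeff F]
    have e1 : (fun v => (F.cone hind hAB hC).duCoeff p q m u v) =
        fun v => v * F.derivOver (p + u • q) m q := by
      funext v
      have := hform _ hu q hq v 0
      rw [zero_smul, add_zero, mul_zero, sub_zero] at this
      exact this
    have e2 : (F.cone hind hAB hC).dvCoeff p q m u 0 = F.dvCoeff p q m u 0 := by
      rw [dvCoeff, dvCoeff, zero_smul, add_zero, hformm _ hu]
    rw [e1, e2, (hasDerivAt_mul_const _).deriv]

theorem camachoSadSet_nonempty (hd : 2 ≤ d) (hF : F.IsReducedConvex) :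
    F.camachoSadSet.Nonempty := by
  obtain ⟨l, hl⟩ : {l : PlaneLine | F.IsInvariant l}.Nonempty := by
    rw [← Set.encard_ne_zero, hF]
    exact_mod_cast (by omega : 3 * d ≠ 0)
  obtain ⟨p, hp, hp0⟩ : ∃ p ∈ l.1, p ≠ 0 := by
    refine (Submodule.ne_bot_iff _).1 fun h => ?_
    have := l.2
    rw [h, finrank_bot] at this
    omega
  obtain ⟨m, hm⟩ : ∃ m, m ∉ l.1 := by
    by_contra! h
    have := l.2
    rw [(Submodule.eq_top_iff' (p := l.1)).2 h, finrank_top] at this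
    simp at this
  obtain ⟨q, hq, hind, hns⟩ := exists_linearIndependent_form_ne_zero hl hp hp0 hm
  obtain ⟨M, hM, -⟩ := exists_isReducedConvexPair hd hF hl hind hp hq hns
  -- At this zero of A + XB the index B/(A + XB)' is not 1; it is nonzero by non-degeneracy.
  obtain ⟨u, hu, hne⟩ := hM.exists_eval_ne
  have hx : p + u • q ∈ l.1 := add_mem hp (l.1.smul_mem _ hq)
  have hind' : LinearIndependent ℂ ![p + u • q, q, m] := by
    rw [linearIndependent_triple_iff] at hind ⊢
    intro x y z hxyz
    obtain ⟨rfl, h2, h3⟩ := hind x (x * u + y) z (by rw [← hxyz]; module)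
    exact ⟨rfl, by simpa using h2, h3⟩
  have h0 : F.form (p + u • q) m = 0 := by
    rw [eval_normalDeriv_add] at hu
    exact neg_eq_zero.1 hu
  obtain ⟨h1, h2, -⟩ := derivOver_ne_zero hd hF hl hind' hx hq h0
  have hder : F.derivOver (p + u • q) q m = -((F.normalDeriv p q m p +
      Polynomial.X * F.normalDeriv p q m q).derivative.eval u) := by
    refine (F.hasDerivAt_form _ q m).unique ?_
    have h3 : (fun v : ℂ => F.form (p + u • q + v • q) m) = fun v =>
        -(F.normalDeriv p q m p + Polynomial.X * F.normalDeriv p q m q).eval (u + v) := by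
      funext v; rw [eval_normalDeriv_add, neg_neg, add_smul, add_assoc]
    rw [h3]
    have h4 := (F.normalDeriv p q m p + Polynomial.X * F.normalDeriv p q m q).hasDerivAt (u + 0)
    have h5 := (h4.comp_const_add u 0).neg
    rwa [add_zero] at h5
  have hne0 : p + u • q ≠ 0 := hind'.ne_zero 0
  have hspan : Submodule.span ℂ {p + u • q} = (Projectivization.mk ℂ _ hne0).submodule :=
    (Projectivization.submodule_mk _ hne0).symm
  have hsing : F.IsSingular (Projectivization.mk ℂ _ hne0) := by
    intro w
    have h3 : (Projectivization.mk ℂ _ hne0).rep ∈ Submodule.span ℂ {p + u • q} := by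
      rw [hspan, Projectivization.submodule_eq]
      exact Submodule.mem_span_singleton_self _
    obtain ⟨a, ha⟩ := Submodule.mem_span_singleton.1 h3
    rw [← ha, form_eq_formOver, formOver_smul_point, ← form_eq_formOver,
      form_eq_zero_of_form_eq_zero hl hx hm h0, mul_zero]
  refine ⟨-(F.derivOver (p + u • q) m q / F.derivOver (p + u • q) q m),
    neg_ne_zero.2 (div_ne_zero h1 h2), ?_, l, Projectivization.mk ℂ _ hne0, hl, ?_,
    isNondegenerateSingular_of_ne_zero hl hsing ⟨hind', hspan⟩ hx hq h1 h2,
    p + u • q, q, m, ⟨hind', hspan⟩, hx, hq, (hasResidue_camachoSad_iff h0 h2 _).2 rfl⟩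
  · intro h
    rw [hder, div_neg, neg_neg, ← eval_normalDeriv, div_eq_one_iff_eq] at h
    · exact hne h
    · exact hM.eval_derivative_ne_zero hu
  · rw [PlanePoint.OnLine, ← hspan, Submodule.span_singleton_le_iff_mem]
    exact hx

end Foliation

end

theorem mainTheorem5 (d : ℕ) (hd : 2 ≤ d) (F : Foliation d) (hF : F.IsReducedConvex) :
    (F.camachoSadSet.Nonempty ∧ F.camachoSadSet ⊆ camachoSadSetOfDegree d) ∧
      ∀ c ∈ F.camachoSadSet, 1 / c ∈ F.camachoSadSet :=
  ⟨⟨Foliation.camachoSadSet_nonempty hd hF, fun _ hc => ⟨hc.1, hc.2.1,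
    Foliation.isHomogeneousConvexIndex_of_mem hd hF hc,
    Foliation.isHomogeneousConvexIndex_of_mem hd hF (Foliation.inv_mem_camachoSadSet hd hF hc)⟩⟩,
    fun _ hc => Foliation.inv_mem_camachoSadSet hd hF hc⟩
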